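/- **Setting.** Let $\mathscr X,\mathscr Y$ be real normed spaces and let $X\subset\mathscr X$, $Y\subset\mathscr Y$ be compact convex sets with diameters $D_X,D_Y$. In round $t=1,2,\dots$ two players choose $(x_t,y_t)\in X\times Y$, and then a continuous convex-concave payoff $f_t:X\times Y\to\mathbb R$ is revealed. There are $d\ge 1$ predictors; before round $t$ the $k$-th one supplies a convex-concave function $h_t^k$ on $X\times Y$. All $f_t$ and $h^k_t$ have bounded subgradients: at each $(x,y)\in X\times Y$ the function has a subgradient in $x$ (relative to $X$) of norm at most $G_X$, and its negative has a subgradient in $y$ (relative to $Y$) of norm at most $G_Y$. With $\rho(f,h)=\max_{X\times Y}|f-h|$, assume $\rho(f_t,h_t^k)\le L_\infty$ for all $t,k$. For a proper $\varphi:\mathscr X\to(-\infty,+\infty]$ and $z\in\mathscr X^*$ put $B_\varphi(x,z)=\varphi(x)+\varphi^\star(z)-\langle z,x\rangle$, where $\varphi^\star$ is the convex conjugate; $x^\varphi$ denotes an element of $\partial\varphi(x)$. The regularizers $\phi$ on $\mathscr X$ and $\psi$ on $\mathscr Y$ are proper, have a subgradient at each point of $X$, resp. $Y$, are $1$-strongly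 convex, i.e. $B_\phi(x,u^\phi)\ge\frac12\|x-u\|^2$ for all $x$, $u$ and $u^\phi\in\partial\phi(u)$ (likewise $\psi$), and satisfy $|B_\phi(x,a^\phi)-B_\phi(x',a^\phi)|\le L_\phi\|x-x'\|$ for $a,x,x'\in X$, $a^\phi\in\partial\phi(a)$ (likewise $\psi$ on $Y$ with $L_\psi$), where $L_\phi,L_\psi>0$. **OptOPPM.** Fix $\epsilon>0$, initial presets $C^1,C^2>0$, starting points $\widetilde x_1\in X$, $\widetilde y_1\in Y$, and $x_0'\in X$, $y_0'\in Y$. In round $t$, given a predictor $h_t$: set $$\eta_t=\frac{L_\phi(D_X+C^1)}{\epsilon+\sum_{\tau<t}\delta^1_\tau},\qquad \gamma_t=\frac{L_\psi(D_Y+C^2)}{\epsilon+\sum_{\tau<t}\delta^2_\tau};$$ let $(x_t,y_t)$ be the saddle point (min over $x\in X$, max over $y\in Y$) of $h_t(x,y)+B_\phi(x,\widetilde x_t^\phi)/\eta_t-B_\psi(y,\widetilde y_t^\psi)/\gamma_t$; observe $f_t$; let $x_t'\in\arg\min_{x\in X} f_t(x,y_t)$, $y_t'\in\arg\max_{y\in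 Y} f_t(x_t,y)$; if $\sum_{\tau\le t}\|x'_\tau-x'_{\tau-1}\|>C^1$, double $C^1$; if $\sum_{\tau\le t}\|y'_\tau-y'_{\tau-1}\|>C^2$, double $C^2$; let $\widetilde x_{t+1}$ minimize $f_t(x,y_t)+B_\phi(x,\widetilde x_t^\phi)/\eta_t$ over $X$ and $\widetilde y_{t+1}$ maximize $f_t(x_t,y)-B_\psi(y,\widetilde y_t^\psi)/\gamma_t$ over $Y$; put $$\delta_t^1=f_t(x_t,y_t)-h_t(x_t,y_t)+h_t(\widetilde x_{t+1},y_t)-f_t(\widetilde x_{t+1},y_t)-B_\phi(\widetilde x_{t+1},x_t^\phi)/\eta_t,$$ $$\delta_t^2=f_t(x_t,\widetilde y_{t+1})-h_t(x_t,\widetilde y_{t+1})+h_t(x_t,y_t)-f_t(x_t,y_t)-B_\psi(\widetilde y_{t+1},y_t^\psi)/\gamma_t.$$ If a regularizer is not differentiable at one of the computed points $x_t,\widetilde x_{t+1},y_t,\widetilde y_{t+1}$, the subgradient attached to this point is the one that occurs in the first-order optimality condition of the problem defining the point (for $x_t$: $\langle\eta_t\nabla_x h_t(x_t,y_t)+x_t^\phi-\widetilde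 x_t^\phi,\,x_t-x\rangle\le0$ for all $x\in X$ and some subgradient $\nabla_xh_t(x_t,y_t)$; similarly for the others). **Clipped Hedge.** The predictor given to OptOPPM is $h_t=\sum_{k=1}^d\omega_t^kh_t^k$. Fix $\epsilon'>0$ and an initial integer preset $N>d$; for $\alpha\ge 0$ let $\triangle_d^{\alpha}$ be the set of probability vectors $w\in\mathbb R^d$ with all $w^i\ge\alpha/d$, and let $\omega_1\in\triangle_d^{d/N}$. In round $t$, after OptOPPM's step: if $t>N$, double $N$; let $L_t^k$ be the maximum of $|f_t-h_t^k|$ over the three points $(x_t,y_t)$, $(\widetilde x_{t+1},y_t)$, $(x_t,\widetilde y_{t+1})$; let $\theta_t=\ln N/(\epsilon'+\sum_{\tau<t}\sigma_\tau)$, let $\omega_{t+1}$ minimize $\theta_t\langle L_t,\omega\rangle+\mathrm{KL}(\omega,\omega_t)$ over $\triangle_d^{d/N}$, and $\sigma_t=\langle L_t,\omega_t-\omega_{t+1}\rangle-\mathrm{KL}(\omega_{t+1},\omega_t)/\theta_t$. **Theorem.** Let $V_T^k=\sum_{t=1}^T\rho(f_t,h_t^k)$, $C_T=\sum_{t=1}^T(\|x_t'-x_{t-1}'\|+\|y_t'-y_{t-1}'\|)$,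 and $$\text{D-Gap}_T=\sum_{t=1}^T\Big(\max_{y\in Y}f_t(x_t,y)-\min_{x\in X}f_t(x,y_t)\Big),\qquad \text{NE-Reg}_T=\Big|\sum_{t=1}^Tf_t(x_t,y_t)-\sum_{t=1}^T\max_{y\in Y}\min_{x\in X}f_t(x,y)\Big|.$$ If the strategy pairs are produced by OptOPPM with the $d$ predictors combined by clipped Hedge as above, then $$\text{D-Gap}_T,\ \text{NE-Reg}_T\le\widetilde O\big(\min\{V_T^1,\dots,V_T^d,\sqrt{(1+C_T)T}\}\big).$$ Precisely: there are an absolute exponent $p\in\mathbb N$ and a constant $K$, depending only on $d$, the initial values of $N,C^1,C^2$, and $\epsilon,\epsilon',D_X,D_Y,G_X,G_Y,L_\phi,L_\psi,L_\infty$, such that for every $T\ge1$ both quantities are at most $$K\,(1+\ln T)^p\,\Big(1+\min\big\{V_T^1,\dots,V_T^d,\sqrt{(1+C_T)T}\big\}\Big).$$ -/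

import Mathlib

namespace OSP

noncomputable section

/-! ### Convex analysis on a real normed space -/

section Convex

variable {E : Type*} [NormedAddCommGroup E] [NormedSpace ℝ E]

/-- A proper extended-real-valued function. -/
def IsProper (φ : E → EReal) : Prop :=
  (∀ x, φ x ≠ ⊥) ∧ ∃ x, φ x ≠ ⊤

/-- The subdifferential `∂φ(x)` of an extended-real-valued function. -/
def subdifferential (φ : E → EReal) (x : E) : Set (E →L[ℝ] ℝ) :=
  {z | φ x ≠ ⊥ ∧ φ x ≠ ⊤ ∧ ∀ x', φ x + ((z (x' - x) : ℝ) : EReal) ≤ φ x'}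

/-- The convex conjugate `φ⋆(z) = sup_x ⟨z, x⟩ - φ(x)`. -/
def conjugate (φ : E → EReal) (z : E →L[ℝ] ℝ) : EReal :=
  ⨆ x, (((z x : ℝ) : EReal) - φ x)

/-- The Fenchel coupling `B_φ(x, z) = φ(x) + φ⋆(z) - ⟨z, x⟩`. -/
def fenchelCoupling (φ : E → EReal) (x : E) (z : E →L[ℝ] ℝ) : EReal :=
  φ x + conjugate φ z - ((z x : ℝ) : EReal)

/-- The Fenchel coupling as a real number; it is finite whenever `φ x` is finite and `z` is a
subgradient of `φ` at some point, which is the only case in which it is used. -/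
def breg (φ : E → EReal) (x : E) (z : E →L[ℝ] ℝ) : ℝ :=
  (fenchelCoupling φ x z).toReal

/-- `μ`-strong convexity: `B_φ(x, y^φ) ≥ (μ / 2) ‖x - y‖²` for all `x`, `y` and `y^φ ∈ ∂φ(y)`. -/
def IsStronglyConvex (μ : ℝ) (φ : E → EReal) : Prop :=
  ∀ x y : E, ∀ z ∈ subdifferential φ y,
    ((μ / 2 * ‖x - y‖ ^ 2 : ℝ) : EReal) ≤ fenchelCoupling φ x z

/-- The standing property of a regularizer on the feasible set `X`: it is proper, has a subgradient
at each feasible point, is `1`-strongly convex, and its Fenchel coupling is `L`-Lipschitz on `X` in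
the first variable. -/
structure IsRegularizer (X : Set E) (L : ℝ) (φ : E → EReal) : Prop where
  proper : IsProper φ
  subdiff_nonempty : ∀ a ∈ X, (subdifferential φ a).Nonempty
  strong : IsStronglyConvex 1 φ
  lipschitz : ∀ a ∈ X, ∀ z ∈ subdifferential φ a, ∀ x ∈ X, ∀ x' ∈ X,
    |breg φ x z - breg φ x' z| ≤ L * ‖x - x'‖

/-- `φ` is (Gateaux) differentiable at `p` relative to `X`, with derivative `z`. -/
def HasGateauxDerivOn (φ : E → EReal) (X : Set E) (p : E) (z : E →L[ℝ] ℝ) : Prop :=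
  ∀ x ∈ X, HasDerivWithinAt (fun s : ℝ => (φ (p + s • (x - p))).toReal) (z (x - p)) (Set.Ici 0) 0

/-- `z` is the subgradient `p^φ` attached to a point `p` that was obtained as a minimizer over `X`
of `η ℓ(x) + B_φ(x, w)`.  Where `φ` is differentiable at `p` there is nothing to choose.  Where it
is not, `p^φ` is the subgradient of `φ` at `p` that appears in the first-order optimality condition
of this minimization, `⟨η ∇ℓ(p) + p^φ - w, p - x⟩ ≤ 0` for all `x ∈ X` and some subgradient
`∇ℓ(p)` on `X`, i.e. `p` minimizes the convex function `η ℓ + p^φ - w` over `X`. -/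
def IsProxSubgradient (φ : E → EReal) (X : Set E) (η : ℝ) (ℓ : E → ℝ) (w : E →L[ℝ] ℝ)
    (p : E) (z : E →L[ℝ] ℝ) : Prop :=
  z ∈ subdifferential φ p ∧
    (HasGateauxDerivOn φ X p z ∨ IsMinOn (fun x => η * ℓ x + (z - w) x) X p)

end Convex

/-! ### Payoff functions and performance metrics -/

section Game

variable {E F : Type*} [NormedAddCommGroup E] [NormedSpace ℝ E]
  [NormedAddCommGroup F] [NormedSpace ℝ F]

/-- `f` is convex-concave on `X × Y`. -/
def ConvexConcaveOn (X : Set E) (Y : Set F) (f : E → F → ℝ) : Prop :=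
  (∀ y ∈ Y, ConvexOn ℝ X fun x => f x y) ∧ ∀ x ∈ X, ConcaveOn ℝ Y (f x)

/-- Bounded subgradients.  Since `f` is a function on `X × Y`, its full subdifferential contains the
unbounded normal cone at boundary points; so the bound is required of one subgradient of
`f(·, y)` at `x`, and one of `-f(x, ·)` at `y`, at every point. -/
def SubgradientBoundedOn (X : Set E) (Y : Set F) (GX GY : ℝ) (f : E → F → ℝ) : Prop :=
  ∀ x ∈ X, ∀ y ∈ Y,
    (∃ g : E →L[ℝ] ℝ, ‖g‖ ≤ GX ∧ ∀ x' ∈ X, f x y + g (x' - x) ≤ f x' y) ∧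
    (∃ g : F →L[ℝ] ℝ, ‖g‖ ≤ GY ∧ ∀ y' ∈ Y, -f x y + g (y' - y) ≤ -f x y')

/-- `ρ(f, h) = max_{X × Y} |f - h|`. -/
def rho (X : Set E) (Y : Set F) (f h : E → F → ℝ) : ℝ :=
  sSup ((fun p : E × F => |f p.1 p.2 - h p.1 p.2|) '' (X ×ˢ Y))

/-- `D-Gap_T`. -/
def dualityGap (X : Set E) (Y : Set F) (f : ℕ → E → F → ℝ) (x : ℕ → E) (y : ℕ → F) (T : ℕ) : ℝ :=
  ∑ t ∈ Finset.Icc 1 T, sSup (f t (x t) '' Y) -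
    ∑ t ∈ Finset.Icc 1 T, sInf ((fun u => f t u (y t)) '' X)

/-- `NE-Reg_T`. -/
def neRegret (X : Set E) (Y : Set F) (f : ℕ → E → F → ℝ) (x : ℕ → E) (y : ℕ → F) (T : ℕ) : ℝ :=
  |∑ t ∈ Finset.Icc 1 T, f t (x t) (y t) -
    ∑ t ∈ Finset.Icc 1 T, sSup ((fun v => sInf ((fun u => f t u v) '' X)) '' Y)|

/-- `V_T = ∑_{t ≤ T} ρ(f_t, h_t)`. -/
def cumError (X : Set E) (Y : Set F) (f h : ℕ → E → F → ℝ) (T : ℕ) : ℝ :=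
  ∑ t ∈ Finset.Icc 1 T, rho X Y (f t) (h t)

/-- `∑_{t ≤ T} ‖u_t - u_{t-1}‖`. -/
def pathLength (u : ℕ → E) (T : ℕ) : ℝ :=
  ∑ t ∈ Finset.Icc 1 T, ‖u t - u (t - 1)‖

/-! ### Optimistic online proximal point method -/

/-- All quantities produced by the optimistic online proximal point method (rounds are numbered
from `1`): strategies `(x_t, y_t)`, auxiliary points `(x̃_t, ỹ_t)`, best responses `(x'_t, y'_t)`
(with arbitrary `x'_0`, `y'_0`), the subgradients `x_t^φ`, `x̃_t^φ`, `y_t^ψ`, `ỹ_t^ψ`, the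
presets `C^1`, `C^2` at the beginning of round `t`, the learning rates and `δ_t^1`, `δ_t^2`. -/
structure Trace (E F : Type*) [NormedAddCommGroup E] [NormedSpace ℝ E]
    [NormedAddCommGroup F] [NormedSpace ℝ F] where
  x : ℕ → E
  y : ℕ → F
  xt : ℕ → E
  yt : ℕ → F
  xBest : ℕ → E
  yBest : ℕ → F
  gx : ℕ → (E →L[ℝ] ℝ)
  gxt : ℕ → (E →L[ℝ] ℝ)
  gy : ℕ → (F →L[ℝ] ℝ)
  gyt : ℕ → (F →L[ℝ] ℝ)
  C1 : ℕ → ℝ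
  C2 : ℕ → ℝ
  η : ℕ → ℝ
  γ : ℕ → ℝ
  δ1 : ℕ → ℝ
  δ2 : ℕ → ℝ

/-- The trace `r` is an execution of the optimistic online proximal point method with adaptive
learning rates, with regularizers `φ`, `ψ`, initial presets `c1`, `c2` and constant `ε`, against
the payoff functions `f` with the predictors `h`. -/
structure IsOptOPPMRun (X : Set E) (Y : Set F) (φ : E → EReal) (ψ : F → EReal)
    (Lφ Lψ ε c1 c2 : ℝ) (f h : ℕ → E → F → ℝ) (r : Trace E F) : Prop where
  -- initialization
  xt_init : r.xt 1 ∈ X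
  yt_init : r.yt 1 ∈ Y
  gxt_init : r.gxt 1 ∈ subdifferential φ (r.xt 1)
  gyt_init : r.gyt 1 ∈ subdifferential ψ (r.yt 1)
  xBest_zero : r.xBest 0 ∈ X
  yBest_zero : r.yBest 0 ∈ Y
  C1_init : r.C1 1 = c1
  C2_init : r.C2 1 = c2
  -- learning rates
  η_eq : ∀ t, 1 ≤ t →
    r.η t = Lφ * (Metric.diam X + r.C1 t) / (ε + ∑ τ ∈ Finset.Ico 1 t, r.δ1 τ)
  γ_eq : ∀ t, 1 ≤ t →
    r.γ t = Lψ * (Metric.diam Y + r.C2 t) / (ε + ∑ τ ∈ Finset.Ico 1 t, r.δ2 τ)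
  -- the strategy pair is the saddle point of the regularized predictor
  x_mem : ∀ t, 1 ≤ t → r.x t ∈ X
  y_mem : ∀ t, 1 ≤ t → r.y t ∈ Y
  saddle : ∀ t, 1 ≤ t → IsSaddlePointOn X Y
    (fun x y => h t x y + breg φ x (r.gxt t) / r.η t - breg ψ y (r.gyt t) / r.γ t) (r.x t) (r.y t)
  gx_mem : ∀ t, 1 ≤ t →
    IsProxSubgradient φ X (r.η t) (fun x => h t x (r.y t)) (r.gxt t) (r.x t) (r.gx t)
  gy_mem : ∀ t, 1 ≤ t →
    IsProxSubgradient ψ Y (r.γ t) (fun y => -h t (r.x t) y) (r.gyt t) (r.y t) (r.gy t)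
  -- best responses and doubling of the presets
  xBest_mem : ∀ t, 1 ≤ t → r.xBest t ∈ X
  xBest_min : ∀ t, 1 ≤ t → IsMinOn (fun x => f t x (r.y t)) X (r.xBest t)
  yBest_mem : ∀ t, 1 ≤ t → r.yBest t ∈ Y
  yBest_max : ∀ t, 1 ≤ t → IsMaxOn (f t (r.x t)) Y (r.yBest t)
  C1_step : ∀ t, 1 ≤ t →
    r.C1 (t + 1) = if r.C1 t < pathLength r.xBest t then 2 * r.C1 t else r.C1 t
  C2_step : ∀ t, 1 ≤ t →
    r.C2 (t + 1) = if r.C2 t < pathLength r.yBest t then 2 * r.C2 t else r.C2 t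
  -- auxiliary points
  xt_mem : ∀ t, 1 ≤ t → r.xt (t + 1) ∈ X
  xt_min : ∀ t, 1 ≤ t →
    IsMinOn (fun x => f t x (r.y t) + breg φ x (r.gxt t) / r.η t) X (r.xt (t + 1))
  gxt_mem : ∀ t, 1 ≤ t →
    IsProxSubgradient φ X (r.η t) (fun x => f t x (r.y t)) (r.gxt t) (r.xt (t + 1)) (r.gxt (t + 1))
  yt_mem : ∀ t, 1 ≤ t → r.yt (t + 1) ∈ Y
  yt_max : ∀ t, 1 ≤ t →
    IsMaxOn (fun y => f t (r.x t) y - breg ψ y (r.gyt t) / r.γ t) Y (r.yt (t + 1))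
  gyt_mem : ∀ t, 1 ≤ t →
    IsProxSubgradient ψ Y (r.γ t) (fun y => -f t (r.x t) y) (r.gyt t) (r.yt (t + 1)) (r.gyt (t + 1))
  -- the quantities entering the learning rates
  δ1_eq : ∀ t, 1 ≤ t → r.δ1 t =
    f t (r.x t) (r.y t) - h t (r.x t) (r.y t) + h t (r.xt (t + 1)) (r.y t)
      - f t (r.xt (t + 1)) (r.y t) - breg φ (r.xt (t + 1)) (r.gx t) / r.η t
  δ2_eq : ∀ t, 1 ≤ t → r.δ2 t =
    f t (r.x t) (r.yt (t + 1)) - h t (r.x t) (r.yt (t + 1)) + h t (r.x t) (r.y t)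
      - f t (r.x t) (r.y t) - breg ψ (r.yt (t + 1)) (r.gy t) / r.γ t

/-! ### Combination of several predictors by the clipped Hedge algorithm -/

/-- The clipped simplex `△_d^α`. -/
def clippedSimplex (d : ℕ) (α : ℝ) : Set (Fin d → ℝ) :=
  {w | (∀ i, 0 ≤ w i) ∧ ∑ i, w i = 1 ∧ ∀ i, α / d ≤ w i}

/-- Kullback-Leibler divergence of weight vectors. -/
def KL {d : ℕ} (w v : Fin d → ℝ) : ℝ :=
  ∑ i, w i * Real.log (w i / v i)

/-- All quantities produced by clipped Hedge: the weights `ω_t`, the value `N_t` of the horizon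
preset used in round `t` (`N_0` is the initial one), the learning rate `θ_t`, and `σ_t`. -/
structure HedgeTrace (d : ℕ) where
  ω : ℕ → Fin d → ℝ
  N : ℕ → ℕ
  θ : ℕ → ℝ
  σ : ℕ → ℝ

/-- The trace `w` is an execution of clipped Hedge with doubling horizon preset, with initial preset
`N₀` and constant `ε`, on the loss vectors `L`. -/
structure IsClippedHedgeRun {d : ℕ} (N₀ : ℕ) (ε : ℝ) (L : ℕ → Fin d → ℝ) (w : HedgeTrace d) :
    Prop where
  N_init : w.N 0 = N₀
  ω_init : w.ω 1 ∈ clippedSimplex d (d / N₀)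
  N_step : ∀ t, 1 ≤ t → w.N t = if w.N (t - 1) < t then 2 * w.N (t - 1) else w.N (t - 1)
  θ_eq : ∀ t, 1 ≤ t → w.θ t = Real.log (w.N t) / (ε + ∑ τ ∈ Finset.Ico 1 t, w.σ τ)
  ω_mem : ∀ t, 1 ≤ t → w.ω (t + 1) ∈ clippedSimplex d (d / w.N t)
  ω_min : ∀ t, 1 ≤ t →
    IsMinOn (fun v => w.θ t * ∑ k, L t k * v k + KL v (w.ω t)) (clippedSimplex d (d / w.N t))
      (w.ω (t + 1))
  σ_eq : ∀ t, 1 ≤ t →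
    w.σ t = ∑ k, L t k * (w.ω t k - w.ω (t + 1) k) - KL (w.ω (t + 1)) (w.ω t) / w.θ t

/-- The combined predictor `h_t = ∑_k ω_t^k h_t^k`. -/
def mixture {d : ℕ} (ω : ℕ → Fin d → ℝ) (h : Fin d → ℕ → E → F → ℝ) : ℕ → E → F → ℝ :=
  fun t x y => ∑ k, ω t k * h k t x y

/-- The loss vectors `L_t` fed to clipped Hedge. -/
def predictorLoss {d : ℕ} (f : ℕ → E → F → ℝ) (h : Fin d → ℕ → E → F → ℝ) (r : Trace E F) :
    ℕ → Fin d → ℝ :=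
  fun t k => max |f t (r.x t) (r.y t) - h k t (r.x t) (r.y t)|
    (max |f t (r.xt (t + 1)) (r.y t) - h k t (r.xt (t + 1)) (r.y t)|
      |f t (r.x t) (r.yt (t + 1)) - h k t (r.x t) (r.yt (t + 1))|)

end Game

end

end OSP

/-! The duality gap is exactly the sum of two dynamic regrets: that of the x-player against its best
responses for the losses f_t(·, y_t), and that of the y-player for -f_t(x_t, ·). The value max min
f_t lies between f_t(x'_t, y_t) and f_t(x_t, y'_t), so NE-Reg is at most the larger of the two
regrets. Everything thus reduces to one player, `IsProxRun`.

For one player, two proximal inequalities bound the regret of a round by δ_t plus a difference of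
Fenchel couplings divided by η_t. Since η_t = L(D + C_t)/Q_t with Q_t = ε + ∑_{τ<t} δ_τ, the
couplings telescope to Q_T times a constant plus the relative drift ∑ ‖u_{t+1} - u_t‖/(D + C_t). The
preset follows the path length within constant factors, so this drift is only logarithmic, and the
regret is O(log T) times ε + ∑ δ (`IsProxRun.regret_le`).

The sum ε + ∑ δ is then bounded in two ways, both valid for the same run, which gives the minimum.
Bounded subgradients give δ_t = O(η_t), hence a square that grows by O(1 + C_T) per round
(`sum_δ_le_sqrt`). On the other hand δ_t is at most twice the error of the mixed predictor, hence at
most twice the Hedge loss ⟨L_t, ω_t⟩. Clipped Hedge has a small-loss bound (`cumulative_loss_le`):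
its loss W exceeds that of predictor k by a polylogarithmic factor times R = ε' + ∑ σ, while R² is
itself O(1 + W log T), so W is at most a power of log T times 1 + V_T^k. -/

namespace OSP

/-! ### Fenchel couplings and the proximal inequality. -/

section Convex

variable {E : Type*} [NormedAddCommGroup E] [NormedSpace ℝ E]

/-- Equality in Fenchel–Young: the supremum is attained at the point where `z` is a subgradient.
This makes the coupling finite, so that `breg` loses nothing by `toReal`. -/
theorem conjugate_eq_of_mem_subdifferential {φ : E → EReal} {a : E} {z : E →L[ℝ] ℝ}
    (hz : z ∈ subdifferential φ a) : conjugate φ z = ((z a - (φ a).toReal : ℝ) : EReal) := by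
  obtain ⟨hbot, htop, hsub⟩ := hz
  have hφ : φ a = ((φ a).toReal : EReal) := (EReal.coe_toReal htop hbot).symm
  apply le_antisymm
  · refine iSup_le fun x => ?_
    have hx := hsub x
    rw [hφ] at hx
    induction hx' : φ x with
    | bot =>
      rw [hx', ← EReal.coe_add] at hx
      exact absurd (le_bot_iff.1 hx) (EReal.coe_ne_bot _)
    | top => simp
    | coe r =>
      rw [hx', ← EReal.coe_add, EReal.coe_le_coe_iff, map_sub] at hx
      rw [← EReal.coe_sub, EReal.coe_le_coe_iff]
      linarith
  · have h := le_iSup (fun x => ((z x : ℝ) : EReal) - φ x) a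
    rw [EReal.coe_sub, ← hφ]
    exact h

theorem fenchelCoupling_eq_coe {φ : E → EReal} {a x : E} {z : E →L[ℝ] ℝ}
    (hz : z ∈ subdifferential φ a) (hbot : φ x ≠ ⊥) (htop : φ x ≠ ⊤) :
    fenchelCoupling φ x z =
      (((φ x).toReal - (φ a).toReal - z (x - a) : ℝ) : EReal) := by
  rw [fenchelCoupling, conjugate_eq_of_mem_subdifferential hz]
  conv_lhs => rw [← EReal.coe_toReal htop hbot]
  rw [← EReal.coe_add, ← EReal.coe_sub, map_sub]
  congr 1
  ring

theorem breg_eq {φ : E → EReal} {a x : E} {z : E →L[ℝ] ℝ}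
    (hz : z ∈ subdifferential φ a) (hbot : φ x ≠ ⊥) (htop : φ x ≠ ⊤) :
    breg φ x z = (φ x).toReal - (φ a).toReal - z (x - a) := by
  rw [breg, fenchelCoupling_eq_coe hz hbot htop, EReal.toReal_coe]

theorem breg_self {φ : E → EReal} {a : E} {z : E →L[ℝ] ℝ} (hz : z ∈ subdifferential φ a) :
    breg φ a z = 0 := by
  rw [breg_eq hz hz.1 hz.2.1]
  simp

namespace IsRegularizer

variable {X : Set E} {L : ℝ} {φ : E → EReal}

theorem ne_bot (hφ : IsRegularizer X L φ) {x : E} (hx : x ∈ X) : φ x ≠ ⊥ :=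
  (hφ.subdiff_nonempty x hx).some_mem.1

theorem ne_top (hφ : IsRegularizer X L φ) {x : E} (hx : x ∈ X) : φ x ≠ ⊤ :=
  (hφ.subdiff_nonempty x hx).some_mem.2.1

theorem half_sq_le_breg (hφ : IsRegularizer X L φ) {a x : E} {z : E →L[ℝ] ℝ} (hx : x ∈ X)
    (hz : z ∈ subdifferential φ a) : 1 / 2 * ‖x - a‖ ^ 2 ≤ breg φ x z := by
  have h := hφ.strong x a z hz
  rw [fenchelCoupling_eq_coe hz (hφ.ne_bot hx) (hφ.ne_top hx), EReal.coe_le_coe_iff] at h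
  rwa [breg_eq hz (hφ.ne_bot hx) (hφ.ne_top hx)]

theorem breg_nonneg (hφ : IsRegularizer X L φ) {a x : E} {z : E →L[ℝ] ℝ} (hx : x ∈ X)
    (hz : z ∈ subdifferential φ a) : 0 ≤ breg φ x z :=
  le_trans (by positivity) (hφ.half_sq_le_breg hx hz)

theorem breg_le (hφ : IsRegularizer X L φ) (hX : Bornology.IsBounded X) (hL : 0 ≤ L) {a x : E}
    {z : E →L[ℝ] ℝ} (ha : a ∈ X) (hx : x ∈ X) (hz : z ∈ subdifferential φ a) :
    breg φ x z ≤ L * Metric.diam X := by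
  have h := (abs_le.mp (hφ.lipschitz a ha z hz x hx a ha)).2
  rw [breg_self hz, sub_zero, ← dist_eq_norm] at h
  exact h.trans (mul_le_mul_of_nonneg_left (Metric.dist_le_diam_of_mem hX hx ha) hL)

/-- The three-point inequality of a proximal step. -/
theorem prox_inequality (hφ : IsRegularizer X L φ) (hX : Convex ℝ X) {η : ℝ} (hη : 0 < η)
    {ℓ : E → ℝ} (hℓ : ConvexOn ℝ X ℓ) {a p u : E} {w z : E →L[ℝ] ℝ}
    (hw : w ∈ subdifferential φ a) (hp : p ∈ X)
    (hmin : IsMinOn (fun x => ℓ x + breg φ x w / η) X p)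
    (hz : IsProxSubgradient φ X η ℓ w p z) (hu : u ∈ X) :
    ℓ p - ℓ u ≤ (breg φ u w - breg φ u z - breg φ p w) / η := by
  have hbu := hφ.ne_bot hu
  have htu := hφ.ne_top hu
  -- First-order optimality of `p`, tested at `u`. If `z` is a derivative of `φ`, it follows by
  -- comparing `p` with the points `p + s • (u - p)`, using convexity of `ℓ`, dividing by `s` and
  -- letting `s → 0`; otherwise it is part of the hypothesis.
  have key : η * ℓ p + (z - w) p ≤ η * ℓ u + (z - w) u := by
    rcases hz.2 with hder | hz2
    · have hd := hder u hu
      rw [hasDerivWithinAt_iff_tendsto_slope] at hd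
      have hlow : ∀ s ∈ Set.Ioo (0 : ℝ) 1,
          w (u - p) - η * (ℓ u - ℓ p) ≤
            slope (fun s : ℝ => (φ (p + s • (u - p))).toReal) 0 s := by
        intro s hs
        have hps : p + s • (u - p) ∈ X := hX.add_smul_sub_mem hp hu ⟨hs.1.le, hs.2.le⟩
        have hm := hmin hps
        simp only [Set.mem_ofPred_eq] at hm
        rw [breg_eq hw (hφ.ne_bot hp) (hφ.ne_top hp),
          breg_eq hw (hφ.ne_bot hps) (hφ.ne_top hps)] at hm
        have hc : ℓ (p + s • (u - p)) ≤ (1 - s) * ℓ p + s * ℓ u := by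
          have := hℓ.2 hp hu (sub_nonneg.2 hs.2.le) hs.1.le (by ring)
          rwa [show (1 - s) • p + s • u = p + s • (u - p) by module, smul_eq_mul,
            smul_eq_mul] at this
        have hm' : η * ℓ p + ((φ p).toReal - (φ a).toReal - w (p - a)) ≤
            η * ((1 - s) * ℓ p + s * ℓ u) +
              ((φ (p + s • (u - p))).toReal - (φ a).toReal - w (p + s • (u - p) - a)) := by
          have h1 := mul_le_mul_of_nonneg_left (hm.trans (add_le_add_left hc _)) hη.le
          rw [mul_add, mul_add, mul_div_cancel₀ _ hη.ne', mul_div_cancel₀ _ hη.ne'] at h1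
          exact h1
        have hwl : w (p + s • (u - p) - a) = w (p - a) + s * w (u - p) := by
          rw [add_sub_right_comm, map_add, map_smul, smul_eq_mul]
        rw [hwl] at hm'
        rw [slope_def_field, le_div_iff₀ (by linarith [hs.1])]
        simp only [zero_smul, add_zero, sub_zero]
        nlinarith
      have hlim : w (u - p) - η * (ℓ u - ℓ p) ≤ z (u - p) := by
        have := left_nhdsWithin_Ioo_neBot (zero_lt_one' ℝ)
        refine ge_of_tendsto (hd.mono_left (nhdsWithin_mono 0 (s := Set.Ioo (0 : ℝ) 1) ?_)) ?_
        · intro s hs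
          exact ⟨hs.1.le, hs.1.ne'⟩
        · exact eventually_mem_nhdsWithin.mono hlow
      simp only [sub_apply, map_sub] at hlim ⊢
      linarith
    · exact hz2 hu
  -- Written out, the three couplings lose all values of `φ` and combine to `(z - w) (u - p)`.
  rw [le_div_iff₀ hη, breg_eq hw hbu htu, breg_eq hz.1 hbu htu,
    breg_eq hw (hφ.ne_bot hp) (hφ.ne_top hp)]
  simp only [sub_apply, map_sub] at key ⊢
  linarith

end IsRegularizer

end Convex

end OSP

/-! ### Dynamic regret of one player. -/

namespace OSP

section PathLength

variable {E : Type*} [NormedAddCommGroup E]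

theorem pathLength_succ (u : ℕ → E) (n : ℕ) :
    pathLength u (n + 1) = pathLength u n + ‖u (n + 1) - u n‖ := by
  simp [pathLength, Finset.sum_Icc_succ_top]

theorem pathLength_nonneg (u : ℕ → E) (n : ℕ) : 0 ≤ pathLength u n :=
  Finset.sum_nonneg fun _ _ => norm_nonneg _

theorem pathLength_mono (u : ℕ → E) : Monotone (pathLength u) :=
  monotone_nat_of_le_succ fun n => by
    rw [pathLength_succ]
    exact le_add_of_nonneg_right (norm_nonneg _)

end PathLength

section ProxRun

variable {E : Type*} [NormedAddCommGroup E] [NormedSpace ℝ E]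

/-- The run of one player of the optimistic online proximal point method: losses `f`, predicted
losses `h`, strategies `x` with subgradients `g`, auxiliary points `a` with subgradients `b`, and
comparators `u` whose path length drives the doubling of the preset `C`. -/
structure IsProxRun (X : Set E) (φ : E → EReal) (L ε c : ℝ) (f h : ℕ → E → ℝ) (x a u : ℕ → E)
    (g b : ℕ → E →L[ℝ] ℝ) (C η δ : ℕ → ℝ) : Prop where
  a_init : a 1 ∈ X
  b_init : b 1 ∈ subdifferential φ (a 1)
  u_mem : ∀ t, u t ∈ X
  C_init : C 1 = c
  η_eq : ∀ t, 1 ≤ t → η t = L * (Metric.diam X + C t) / (ε + ∑ τ ∈ Finset.Ico 1 t, δ τ)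
  x_mem : ∀ t, 1 ≤ t → x t ∈ X
  x_min : ∀ t, 1 ≤ t → IsMinOn (fun v => h t v + breg φ v (b t) / η t) X (x t)
  g_mem : ∀ t, 1 ≤ t → IsProxSubgradient φ X (η t) (h t) (b t) (x t) (g t)
  C_step : ∀ t, 1 ≤ t → C (t + 1) = if C t < pathLength u t then 2 * C t else C t
  a_mem : ∀ t, 1 ≤ t → a (t + 1) ∈ X
  a_min : ∀ t, 1 ≤ t → IsMinOn (fun v => f t v + breg φ v (b t) / η t) X (a (t + 1))
  b_mem : ∀ t, 1 ≤ t → IsProxSubgradient φ X (η t) (f t) (b t) (a (t + 1)) (b (t + 1))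
  δ_eq : ∀ t, 1 ≤ t →
    δ t = f t (x t) - h t (x t) + h t (a (t + 1)) - f t (a (t + 1)) - breg φ (a (t + 1)) (g t) / η t

/-- The factor in front of `(1 + log T) (ε + ∑ δ)` in the regret bound of a proximal run. -/
noncomputable def proxRegretConst (D c : ℝ) : ℝ :=
  2 + (2 * (1 + D / c) + 1) * (1 + Real.log (1 + D / c))

/-- The factor in front of `√((1 + P) T)` in the bound on `ε + ∑ δ` of a proximal run whose
comparators have path length `P`. -/
noncomputable def proxStabilityConst (D G L M ε c : ℝ) : ℝ :=
  √(ε ^ 2 + M ^ 2 + 4 * G ^ 2 * L * (D + c + 2))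

namespace IsProxRun

variable {X : Set E} {φ : E → EReal} {L ε c : ℝ} {f h : ℕ → E → ℝ} {x a u : ℕ → E}
  {g b : ℕ → E →L[ℝ] ℝ} {C η δ : ℕ → ℝ}

theorem aux_mem (hr : IsProxRun X φ L ε c f h x a u g b C η δ) {t : ℕ} (ht : 1 ≤ t) :
    a t ∈ X := by
  obtain rfl | ht' := ht.eq_or_lt
  · exact hr.a_init
  · have := hr.a_mem (t - 1) (by omega)
    rwa [Nat.sub_add_cancel ht] at this

theorem aux_subgradient (hr : IsProxRun X φ L ε c f h x a u g b C η δ) {t : ℕ} (ht : 1 ≤ t) :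
    b t ∈ subdifferential φ (a t) := by
  obtain rfl | ht' := ht.eq_or_lt
  · exact hr.b_init
  · have := (hr.b_mem (t - 1) (by omega)).1
    rwa [Nat.sub_add_cancel ht] at this

theorem norm_step_le (hr : IsProxRun X φ L ε c f h x a u g b C η δ) (hX : Bornology.IsBounded X)
    (s t : ℕ) : ‖u s - u t‖ ≤ Metric.diam X := by
  rw [← dist_eq_norm]
  exact Metric.dist_le_diam_of_mem hX (hr.u_mem s) (hr.u_mem t)

theorem pathLength_le (hr : IsProxRun X φ L ε c f h x a u g b C η δ) (hX : Bornology.IsBounded X)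
    (n : ℕ) : pathLength u n ≤ Metric.diam X * n := by
  induction n with
  | zero => simp [pathLength]
  | succ n ih =>
    rw [pathLength_succ]
    push_cast
    linarith [hr.norm_step_le hX (n + 1) n]

theorem preset_pos (hr : IsProxRun X φ L ε c f h x a u g b C η δ) (hc : 0 < c) {t : ℕ}
    (ht : 1 ≤ t) : c ≤ C t := by
  induction t, ht using Nat.le_induction with
  | base => exact hr.C_init.ge
  | succ t ht ih =>
    rw [hr.C_step t ht]
    split_ifs <;> linarith

theorem preset_le_succ (hr : IsProxRun X φ L ε c f h x a u g b C η δ) (hc : 0 < c) {t : ℕ}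
    (ht : 1 ≤ t) : C t ≤ C (t + 1) := by
  have := hr.preset_pos hc ht
  rw [hr.C_step t ht]
  split_ifs <;> linarith

theorem preset_succ_le (hr : IsProxRun X φ L ε c f h x a u g b C η δ) (hc : 0 < c) {t : ℕ}
    (ht : 1 ≤ t) : C (t + 1) ≤ 2 * C t := by
  have := hr.preset_pos hc ht
  rw [hr.C_step t ht]
  split_ifs <;> linarith

/-- A doubling occurs only when the preset is below the path length, so the doubled value is below
twice that length. -/
theorem preset_le (hr : IsProxRun X φ L ε c f h x a u g b C η δ) (hc : 0 < c) {t : ℕ}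
    (ht : 1 ≤ t) : C t ≤ c + 2 * pathLength u t := by
  induction t, ht using Nat.le_induction with
  | base => linarith [hr.C_init, pathLength_nonneg u 1]
  | succ t ht ih =>
    have := pathLength_mono u (Nat.le_succ t)
    rw [Nat.succ_eq_add_one] at this
    rw [hr.C_step t ht]
    split_ifs <;> linarith

/-- The preset reacts one round late, but one increment of the path is at most `diam X`, hence at
most `diam X / c` times the preset; one doubling per round keeps up. -/
theorem pathLength_le_preset (hr : IsProxRun X φ L ε c f h x a u g b C η δ)
    (hX : Bornology.IsBounded X) (hc : 0 < c) {t : ℕ} (ht : 1 ≤ t) :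
    pathLength u t ≤ (1 + Metric.diam X / c) * C t := by
  have hD : 0 ≤ Metric.diam X := Metric.diam_nonneg
  have hDc : ∀ t, 1 ≤ t → Metric.diam X ≤ Metric.diam X / c * C t := fun t ht => by
    rw [div_mul_eq_mul_div, le_div_iff₀ hc]
    exact mul_le_mul_of_nonneg_left (hr.preset_pos hc ht) hD
  induction t, ht using Nat.le_induction with
  | base =>
    have h1 := hr.pathLength_le hX 1
    have h2 := hDc 1 le_rfl
    have h3 := hr.preset_pos hc le_rfl
    push_cast at h1
    linarith
  | succ t ht ih =>
    have h1 := hr.norm_step_le hX (t + 1) t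
    have h2 := hDc t ht
    have h3 := hr.preset_pos hc ht
    rw [pathLength_succ, hr.C_step t ht]
    split_ifs with hlt <;> linarith

/-- The two claims need a joint induction: `η t` is positive because the earlier `δ` are
nonnegative. Then `δ t ≥ 0` follows by adding the proximal inequality of `x t` tested at `a (t + 1)`
to the minimality of `a (t + 1)` tested at `x t`. -/
theorem η_pos_and_δ_nonneg (hr : IsProxRun X φ L ε c f h x a u g b C η δ)
    (hφ : IsRegularizer X L φ) (hX : Convex ℝ X) (hL : 0 < L) (hε : 0 < ε) (hc : 0 < c)
    (hh : ∀ t, 1 ≤ t → ConvexOn ℝ X (h t)) (t : ℕ) (ht : 1 ≤ t) : 0 < η t ∧ 0 ≤ δ t := by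
  induction t using Nat.strong_induction_on with
  | _ t ih =>
    have hQ : 0 < ε + ∑ τ ∈ Finset.Ico 1 t, δ τ :=
      add_pos_of_pos_of_nonneg hε <| Finset.sum_nonneg fun τ hτ => by
        rw [Finset.mem_Ico] at hτ
        exact (ih τ hτ.2 hτ.1).2
    have hη : 0 < η t := by
      rw [hr.η_eq t ht]
      have := hr.preset_pos hc ht
      have hD : 0 ≤ Metric.diam X := Metric.diam_nonneg
      exact div_pos (mul_pos hL (by linarith)) hQ
    refine ⟨hη, ?_⟩
    have h1 := hφ.prox_inequality hX hη (hh t ht) (hr.aux_subgradient ht) (hr.x_mem t ht)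
      (hr.x_min t ht) (hr.g_mem t ht) (hr.a_mem t ht)
    have h2 := hr.a_min t ht (hr.x_mem t ht)
    simp only [Set.mem_ofPred_eq] at h2
    rw [hr.δ_eq t ht]
    rw [sub_div, sub_div] at h1
    linarith

/-- The source of the bound by prediction errors. -/
theorem δ_le_of_abs_le (hr : IsProxRun X φ L ε c f h x a u g b C η δ)
    (hφ : IsRegularizer X L φ) {t : ℕ} (ht : 1 ≤ t) (hη : 0 < η t) {m : ℝ}
    (hx : |f t (x t) - h t (x t)| ≤ m) (ha : |f t (a (t + 1)) - h t (a (t + 1))| ≤ m) :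
    δ t ≤ 2 * m := by
  have h1 := div_nonneg (hφ.breg_nonneg (hr.a_mem t ht) (hr.g_mem t ht).1) hη.le
  rw [hr.δ_eq t ht]
  linarith [(abs_le.1 hx).2, (abs_le.1 ha).1]

/-- The source of the square-root bound: with n the distance from `x t` to `a (t + 1)`, the losses
contribute at most 2Gn, strong convexity subtracts n²/(2η), and completing the square leaves 2ηG².
-/
theorem δ_le_of_subgradient (hr : IsProxRun X φ L ε c f h x a u g b C η δ)
    (hφ : IsRegularizer X L φ) {t : ℕ} (ht : 1 ≤ t) (hη : 0 < η t) {G : ℝ}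
    (hf : ∀ v ∈ X, ∀ v' ∈ X, f t v - f t v' ≤ G * ‖v - v'‖)
    (hh : ∀ v ∈ X, ∀ v' ∈ X, h t v - h t v' ≤ G * ‖v - v'‖) :
    δ t ≤ 2 * η t * G ^ 2 := by
  have h1 := hφ.half_sq_le_breg (hr.a_mem t ht) (hr.g_mem t ht).1
  have h2 := hf _ (hr.x_mem t ht) _ (hr.a_mem t ht)
  have h3 := hh _ (hr.a_mem t ht) _ (hr.x_mem t ht)
  rw [norm_sub_rev] at h2
  rw [hr.δ_eq t ht]
  set n := ‖a (t + 1) - x t‖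
  have h4 : 1 / 2 * n ^ 2 / η t ≤ breg φ (a (t + 1)) (g t) / η t := by gcongr
  have h5 : 2 * (G * n) - 1 / 2 * n ^ 2 / η t ≤ 2 * η t * G ^ 2 := by
    have h6 : 2 * η t * G ^ 2 - (2 * (G * n) - 1 / 2 * n ^ 2 / η t) =
        (2 * η t * G - n) ^ 2 / (2 * η t) := by
      field_simp
      ring
    have h7 : 0 ≤ (2 * η t * G - n) ^ 2 / (2 * η t) := by positivity
    linarith
  linarith

/-- Add the proximal inequality for `h t` from `x t` to `a (t + 1)` and the one for `f t` from `a (t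
+ 1)` to `u t`; the mismatch between `f t` and `h t` is what `δ t` records. -/
theorem step_regret_le (hr : IsProxRun X φ L ε c f h x a u g b C η δ)
    (hφ : IsRegularizer X L φ) (hX : Convex ℝ X) {t : ℕ} (ht : 1 ≤ t) (hη : 0 < η t)
    (hf : ConvexOn ℝ X (f t)) (hh : ConvexOn ℝ X (h t)) :
    f t (x t) - f t (u t) ≤ δ t + (breg φ (u t) (b t) / η t - breg φ (u t) (b (t + 1)) / η t) := by
  have h1 := hφ.prox_inequality hX hη hh (hr.aux_subgradient ht) (hr.x_mem t ht)
    (hr.x_min t ht) (hr.g_mem t ht) (hr.a_mem t ht)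
  have h2 := hφ.prox_inequality hX hη hf (hr.aux_subgradient ht) (hr.a_mem t ht)
    (hr.a_min t ht) (hr.b_mem t ht) (hr.u_mem t)
  have h3 := div_nonneg (hφ.breg_nonneg (hr.x_mem t ht) (hr.aux_subgradient ht)) hη.le
  rw [hr.δ_eq t ht]
  rw [sub_div, sub_div] at h1 h2
  linarith

/-- The telescoped Fenchel couplings, with the effect of the moving comparator and of the doubling
of the preset. -/
theorem telescope_le (hr : IsProxRun X φ L ε c f h x a u g b C η δ)
    (hφ : IsRegularizer X L φ) (hXb : Bornology.IsBounded X) (hX : Convex ℝ X) (hL : 0 < L)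
    (hε : 0 < ε) (hc : 0 < c) (hh : ∀ t, 1 ≤ t → ConvexOn ℝ X (h t)) {n : ℕ} (hn : 1 ≤ n) :
    ∑ t ∈ Finset.Icc 1 n, (breg φ (u t) (b t) / η t - breg φ (u t) (b (t + 1)) / η t)
        + breg φ (u n) (b (n + 1)) / η n ≤
      (ε + ∑ τ ∈ Finset.Ico 1 n, δ τ) * (1 + (2 * (1 + Metric.diam X / c) + 1) *
        (Real.log (c + pathLength u n) - Real.log c)) := by
  have hD : 0 ≤ Metric.diam X := Metric.diam_nonneg
  set D := Metric.diam X
  set Q : ℕ → ℝ := fun n => ε + ∑ τ ∈ Finset.Ico 1 n, δ τ with hQdef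
  have hδ := fun t ht => (hr.η_pos_and_δ_nonneg hφ hX hL hε hc hh t ht).2
  have hQ : ∀ n, 0 < Q n := fun n =>
    add_pos_of_pos_of_nonneg hε <| Finset.sum_nonneg fun τ hτ =>
      hδ τ (Finset.mem_Ico.1 hτ).1
  have hQs : ∀ n, 1 ≤ n → Q (n + 1) = Q n + δ n := fun n hn => by
    simp only [hQdef, Finset.sum_Ico_succ_top hn, add_assoc]
  have hB0 : ∀ s t, 1 ≤ t → 0 ≤ breg φ (u s) (b t) := fun s t ht =>
    hφ.breg_nonneg (hr.u_mem s) (hr.aux_subgradient ht)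
  have hB : ∀ s t, 1 ≤ t → breg φ (u s) (b t) ≤ L * D := fun s t ht =>
    hφ.breg_le hXb hL.le (hr.aux_mem ht) (hr.u_mem s) (hr.aux_subgradient ht)
  have hη : ∀ (t : ℕ) (z : ℝ), 1 ≤ t → z / η t = z / L * (Q t / (D + C t)) := fun t z ht => by
    rw [hr.η_eq t ht, div_div_eq_mul_div, mul_div_mul_comm]
  have hC := fun t ht => hr.preset_pos hc (t := t) ht
  set A := 1 + D / c with hA
  have hA0 : 0 ≤ D / c := by positivity
  change _ ≤ Q n * _
  -- The extra coupling on the left cancels the negative half of the last summand, so each induction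
  -- step only has to bound the increment `hinc`.
  induction n, hn using Nat.le_induction with
  | base =>
    have h1 : (0 : ℝ) ≤ Real.log (c + pathLength u 1) - Real.log c :=
      sub_nonneg.2 (Real.log_le_log hc (by linarith [pathLength_nonneg u 1]))
    have h2 : breg φ (u 1) (b 1) / η 1 ≤ Q 1 := by
      rw [hη 1 _ le_rfl]
      have h3 : breg φ (u 1) (b 1) / L ≤ D := by
        rw [div_le_iff₀ hL, mul_comm]; exact hB 1 1 le_rfl
      have h4 := hC 1 le_rfl
      have h5 : 0 < D + C 1 := by linarith
      rw [mul_div_assoc', div_le_iff₀ h5, mul_comm (Q 1)]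
      exact mul_le_mul_of_nonneg_right (by linarith) (hQ 1).le
    simp only [Finset.Icc_self, Finset.sum_singleton]
    have h6 : 0 ≤ Q 1 * ((2 * A + 1) * (Real.log (c + pathLength u 1) - Real.log c)) :=
      mul_nonneg (hQ 1).le (mul_nonneg (by positivity) h1)
    linarith
  | succ n hn ih =>
    set lg := Real.log (c + pathLength u n) - Real.log c with hlg
    set lg' := Real.log (c + pathLength u (n + 1)) - Real.log c with hlg'
    have hP := pathLength_nonneg u n
    have hP' := pathLength_nonneg u (n + 1)
    set p := ‖u (n + 1) - u n‖ with hp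
    have hp0 : 0 ≤ p := norm_nonneg _
    have hPs : pathLength u (n + 1) = pathLength u n + p := pathLength_succ u n
    have hlg0 : 0 ≤ lg := sub_nonneg.2 (Real.log_le_log hc (by linarith))
    have hCn := hC n hn
    have hCn1 := hr.preset_le_succ hc hn
    have hDC : 0 < D + C n := by linarith
    have hDC1 : 0 < D + C (n + 1) := by linarith
    -- the comparator drift is charged to the growth of the logarithm of the path length
    have hdrift : p / (D + C n) ≤ (2 * A + 1) * (lg' - lg) := by
      have h1 : (c + pathLength u (n + 1)) ≤ (2 * A + 1) * (D + C n) := by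
        have h2 := hr.pathLength_le_preset hXb hc (t := n + 1) (by omega)
        have h3 := hr.preset_succ_le hc hn
        have h4 : A * C (n + 1) ≤ A * (2 * C n) := mul_le_mul_of_nonneg_left h3 (by positivity)
        have h5 : 0 ≤ A * D := by positivity
        change _ ≤ A * _ at h2
        linarith
      have h6 : p / (c + pathLength u (n + 1)) ≤ lg' - lg := by
        have h7 : 0 < c + pathLength u (n + 1) := by linarith
        have h8 : 0 < c + pathLength u n := by linarith
        have h9 := Real.one_sub_inv_le_log_of_pos (div_pos h7 h8)
        rw [Real.log_div h7.ne' h8.ne', inv_div] at h9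
        have h10 : p / (c + pathLength u (n + 1)) =
            1 - (c + pathLength u n) / (c + pathLength u (n + 1)) := by
          rw [eq_sub_iff_add_eq, ← add_div, div_eq_one_iff_eq h7.ne']
          linarith
        rw [h10]
        linarith
      calc p / (D + C n) ≤ (2 * A + 1) * (p / (c + pathLength u (n + 1))) := by
            rw [mul_div_assoc', div_le_div_iff₀ hDC (by linarith)]
            nlinarith
        _ ≤ _ := mul_le_mul_of_nonneg_left h6 (by positivity)
    -- Two effects: the rate changes, which costs at most `δ n` because `β ≤ D` and a larger preset
    -- only helps; and the comparator moves, which costs `hdrift` times `Q n`.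
    have hinc : breg φ (u (n + 1)) (b (n + 1)) / η (n + 1) - breg φ (u n) (b (n + 1)) / η n ≤
        δ n + Q n * ((2 * A + 1) * (lg' - lg)) := by
      have h1 := (abs_le.1 (hφ.lipschitz _ (hr.aux_mem (t := n + 1) (by omega)) _
        (hr.aux_subgradient (t := n + 1) (by omega)) _ (hr.u_mem (n + 1)) _ (hr.u_mem n))).2
      rw [hη (n + 1) _ (by omega), hη n _ hn]
      set β := breg φ (u (n + 1)) (b (n + 1)) / L with hβ
      set β' := breg φ (u n) (b (n + 1)) / L with hβ'
      have hβ0 : 0 ≤ β := div_nonneg (hB0 _ _ (by omega)) hL.le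
      have hβD : β ≤ D := by
        rw [hβ, div_le_iff₀ hL, mul_comm]; exact hB _ _ (by omega)
      have hββ : β - β' ≤ p := by
        rw [hβ, hβ', ← sub_div, div_le_iff₀ hL, mul_comm]; exact h1
      have h2 : Q (n + 1) / (D + C (n + 1)) ≤ δ n / (D + C (n + 1)) + Q n / (D + C n) := by
        rw [hQs n hn, add_div, add_comm]
        gcongr
        exact (hQ n).le
      have h3 : β * (δ n / (D + C (n + 1))) ≤ δ n := by
        rw [mul_div_assoc', div_le_iff₀ hDC1, mul_comm (δ n)]
        exact mul_le_mul_of_nonneg_right (by linarith) (hδ n hn)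
      have h4 : (β - β') * (Q n / (D + C n)) ≤ Q n * ((2 * A + 1) * (lg' - lg)) := by
        calc (β - β') * (Q n / (D + C n)) ≤ p * (Q n / (D + C n)) :=
              mul_le_mul_of_nonneg_right hββ (div_nonneg (hQ n).le hDC.le)
          _ = Q n * (p / (D + C n)) := by ring
          _ ≤ _ := mul_le_mul_of_nonneg_left hdrift (hQ n).le
      have h5 := mul_le_mul_of_nonneg_left h2 hβ0
      linarith
    rw [Finset.sum_Icc_succ_top (by omega)]
    have hA2 : 0 ≤ 2 * A + 1 := by positivity
    have hlgl : lg ≤ lg' := by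
      have h1 : 0 ≤ p / (D + C n) := div_nonneg hp0 hDC.le
      by_contra hcon
      push Not at hcon
      have h2 : (2 * A + 1) * (lg' - lg) < 0 :=
        mul_neg_of_pos_of_neg (by positivity) (by linarith)
      linarith
    have h1 : 0 ≤ δ n * ((2 * A + 1) * lg') :=
      mul_nonneg (hδ n hn) (mul_nonneg hA2 (hlg0.trans hlgl))
    rw [hQs n hn]
    linarith

theorem regret_le (hr : IsProxRun X φ L ε c f h x a u g b C η δ)
    (hφ : IsRegularizer X L φ) (hXb : Bornology.IsBounded X) (hX : Convex ℝ X) (hL : 0 < L)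
    (hε : 0 < ε) (hc : 0 < c) (hf : ∀ t, 1 ≤ t → ConvexOn ℝ X (f t))
    (hh : ∀ t, 1 ≤ t → ConvexOn ℝ X (h t)) {T : ℕ} (hT : 1 ≤ T) :
    ∑ t ∈ Finset.Icc 1 T, (f t (x t) - f t (u t)) ≤
      proxRegretConst (Metric.diam X) c * (1 + Real.log T) * (ε + ∑ t ∈ Finset.Icc 1 T, δ t) := by
  rw [proxRegretConst]
  have hD : 0 ≤ Metric.diam X := Metric.diam_nonneg
  have hηδ := hr.η_pos_and_δ_nonneg hφ hX hL hε hc hh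
  have hT' : (1 : ℝ) ≤ T := by exact_mod_cast hT
  have hIco : Finset.Ico 1 (T + 1) = Finset.Icc 1 T := rfl
  have hsum : ∑ t ∈ Finset.Icc 1 T, (f t (x t) - f t (u t)) ≤
      ∑ t ∈ Finset.Icc 1 T, δ t +
        ∑ t ∈ Finset.Icc 1 T, (breg φ (u t) (b t) / η t - breg φ (u t) (b (t + 1)) / η t) := by
    rw [← Finset.sum_add_distrib]
    refine Finset.sum_le_sum fun t ht => ?_
    have ht := (Finset.mem_Icc.1 ht).1
    exact hr.step_regret_le hφ hX ht (hηδ t ht).1 (hf t ht) (hh t ht)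
  have htel := hr.telescope_le hφ hXb hX hL hε hc hh hT
  have hlast : 0 ≤ breg φ (u T) (b (T + 1)) / η T :=
    div_nonneg (hφ.breg_nonneg (hr.u_mem T) (hr.aux_subgradient (by omega))) (hηδ T hT).1.le
  set A := 1 + Metric.diam X / c with hA
  have hA1 : 1 ≤ A := by
    rw [hA]
    linarith [div_nonneg hD hc.le]
  set Q := ε + ∑ t ∈ Finset.Icc 1 T, δ t with hQ
  have hΔ : 0 ≤ ∑ t ∈ Finset.Icc 1 T, δ t :=
    Finset.sum_nonneg fun t ht => (hηδ t (Finset.mem_Icc.1 ht).1).2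
  have hQ0 : 0 < Q := by linarith
  have hQT : ε + ∑ τ ∈ Finset.Ico 1 T, δ τ ≤ Q := by
    rw [hQ, ← hIco, Finset.sum_Ico_succ_top hT]
    linarith [(hηδ T hT).2]
  have hlogA : 0 ≤ Real.log A := Real.log_nonneg hA1
  have hlogT : 0 ≤ Real.log T := Real.log_nonneg hT'
  -- The path length is at most `diam X * T`, so its ratio to `c` is polynomial in `T`.
  have hlog : Real.log (c + pathLength u T) - Real.log c ≤ Real.log A + Real.log T := by
    have hP := pathLength_nonneg u T
    rw [← Real.log_mul (by linarith) (by linarith), ← Real.log_div (by linarith) hc.ne']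
    refine Real.log_le_log (div_pos (by linarith) hc) ?_
    rw [div_le_iff₀ hc]
    have h1 := hr.pathLength_le hXb T
    have h2 : A * T * c = c * T + Metric.diam X * T := by
      rw [hA]
      field_simp
    rw [h2]
    nlinarith
  have h1 : 0 ≤ Real.log (c + pathLength u T) - Real.log c :=
    sub_nonneg.2 (Real.log_le_log hc (by linarith [pathLength_nonneg u T]))
  have h2 : (ε + ∑ τ ∈ Finset.Ico 1 T, δ τ) * (1 + (2 * A + 1) *
      (Real.log (c + pathLength u T) - Real.log c)) ≤
      Q * (1 + (2 * A + 1) * (Real.log A + Real.log T)) := by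
    gcongr
  have h3 : Q * (2 + (2 * A + 1) * (Real.log A + Real.log T)) ≤
      (2 + (2 * A + 1) * (1 + Real.log A)) * (1 + Real.log T) * Q := by
    rw [mul_comm]
    refine mul_le_mul_of_nonneg_right ?_ hQ0.le
    have h4 : 0 ≤ (2 * A + 1) * (1 + Real.log A * Real.log T) := by positivity
    linarith
  linarith

/-- Self-bounding: with Q = ε + (sum of the earlier `δ`), the square grows by 2Qδ + δ² in a round.
As δ ≤ 2ηG² and ηQ = L(D + C) by the choice of the rate, Qδ is bounded by the preset, hence by the
path length. -/
theorem sum_δ_le_sqrt (hr : IsProxRun X φ L ε c f h x a u g b C η δ)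
    (hφ : IsRegularizer X L φ) (hX : Convex ℝ X) (hL : 0 < L)
    (hε : 0 < ε) (hc : 0 < c) (hh : ∀ t, 1 ≤ t → ConvexOn ℝ X (h t)) {G M : ℝ}
    (hfG : ∀ t, 1 ≤ t → ∀ v ∈ X, ∀ v' ∈ X, f t v - f t v' ≤ G * ‖v - v'‖)
    (hhG : ∀ t, 1 ≤ t → ∀ v ∈ X, ∀ v' ∈ X, h t v - h t v' ≤ G * ‖v - v'‖)
    (hM : ∀ t, 1 ≤ t → δ t ≤ M) {T : ℕ} (hT : 1 ≤ T) :
    ε + ∑ t ∈ Finset.Icc 1 T, δ t ≤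
      proxStabilityConst (Metric.diam X) G L M ε c * √((1 + pathLength u T) * T) := by
  rw [proxStabilityConst]
  have hD : 0 ≤ Metric.diam X := Metric.diam_nonneg
  set D := Metric.diam X
  have hηδ := hr.η_pos_and_δ_nonneg hφ hX hL hε hc hh
  have hstep : ∀ n, n ≤ T → (ε + ∑ t ∈ Finset.Icc 1 n, δ t) ^ 2 ≤
      ε ^ 2 + n * (4 * G ^ 2 * L * (D + c + 2 * pathLength u T) + M ^ 2) := by
    intro n
    induction n with
    | zero => simp
    | succ n ih =>
      intro hn
      have ih := ih (by omega)
      have hn1 : 1 ≤ n + 1 := by omega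
      rw [Finset.sum_Icc_succ_top hn1, ← add_assoc]
      set Q := ε + ∑ t ∈ Finset.Icc 1 n, δ t with hQ
      have hQ0 : 0 < Q := add_pos_of_pos_of_nonneg hε <|
        Finset.sum_nonneg fun t ht => (hηδ t (Finset.mem_Icc.1 ht).1).2
      have h1 := hr.δ_le_of_subgradient hφ hn1 (hηδ _ hn1).1 (hfG _ hn1) (hhG _ hn1)
      have h2 : η (n + 1) * Q = L * (D + C (n + 1)) := by
        rw [hr.η_eq _ hn1]
        exact div_mul_cancel₀ _ hQ0.ne'
      have h3 : C (n + 1) ≤ c + 2 * pathLength u T :=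
        (hr.preset_le hc hn1).trans (by linarith [pathLength_mono u hn])
      have h4 : Q * δ (n + 1) ≤ 2 * G ^ 2 * L * (D + c + 2 * pathLength u T) := by
        calc Q * δ (n + 1) ≤ Q * (2 * η (n + 1) * G ^ 2) := mul_le_mul_of_nonneg_left h1 hQ0.le
          _ = 2 * G ^ 2 * (η (n + 1) * Q) := by ring
          _ = 2 * G ^ 2 * L * (D + C (n + 1)) := by rw [h2]; ring
          _ ≤ 2 * G ^ 2 * L * (D + c + 2 * pathLength u T) := 
            mul_le_mul_of_nonneg_left (by linarith) (by positivity)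
      have h5 : δ (n + 1) ^ 2 ≤ M ^ 2 := pow_le_pow_left₀ (hηδ _ hn1).2 (hM _ hn1) 2
      push_cast
      linarith
  have hP := pathLength_nonneg u T
  have hT' : (1 : ℝ) ≤ T := by exact_mod_cast hT
  rw [← Real.sqrt_mul (by positivity)]
  refine Real.le_sqrt_of_sq_le ((hstep T le_rfl).trans ?_)
  set P := pathLength u T
  have h1 : ε ^ 2 ≤ ε ^ 2 * ((1 + P) * T) :=
    le_mul_of_one_le_right (sq_nonneg _) (by nlinarith)
  have h2 : 4 * G ^ 2 * L * (D + c + 2 * P) + M ^ 2 ≤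
      (M ^ 2 + 4 * G ^ 2 * L * (D + c + 2)) * (1 + P) := by
    have h3 : 0 ≤ 4 * G ^ 2 * L * (2 + (D + c) * P) := by positivity
    have h4 : 0 ≤ M ^ 2 * P := by positivity
    linarith
  have h5 := mul_le_mul_of_nonneg_left h2 (zero_le_one.trans hT')
  linarith

end IsProxRun

end ProxRun

end OSP

/-! ### Relative entropy and entropic mirror steps. -/

namespace OSP

section Hedge

variable {d : ℕ}

theorem mem_clippedSimplex_iff {N : ℕ} {v : Fin d → ℝ} :
    v ∈ clippedSimplex d (d / N) ↔ ∑ i, v i = 1 ∧ ∀ i, 1 / (N : ℝ) ≤ v i := by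
  have aux (i : Fin d) : (d : ℝ) / N / d = 1 / (N : ℝ) := by
    have : (d : ℝ) ≠ 0 := by
      have := i.pos
      positivity
    field_simp
  refine ⟨fun h => ⟨h.2.1, fun i => (aux i).symm.trans_le (h.2.2 i)⟩, fun h =>
    ⟨fun i => le_trans (by positivity) (h.2 i), h.1, fun i => (aux i).trans_le (h.2 i)⟩⟩

theorem le_one_of_sum_eq_one {v : Fin d → ℝ} (hv : ∀ i, 0 ≤ v i) (hs : ∑ i, v i = 1) (i : Fin d) :
    v i ≤ 1 :=
  hs ▸ Finset.single_le_sum (fun j _ => hv j) (Finset.mem_univ i)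

theorem KL_nonneg {v w : Fin d → ℝ} (hv : ∀ i, 0 < v i) (hw : ∀ i, 0 < w i)
    (hs : ∑ i, v i = ∑ i, w i) : 0 ≤ KL v w := by
  have : ∑ i, (v i - w i) ≤ KL v w := by
    refine Finset.sum_le_sum fun i _ => ?_
    have h := Real.one_sub_inv_le_log_of_pos (div_pos (hv i) (hw i))
    calc v i - w i = v i * (1 - (v i / w i)⁻¹) := by
          rw [inv_div]
          have := (hv i).ne'
          field_simp
      _ ≤ _ := mul_le_mul_of_nonneg_left h (hv i).le
  rwa [Finset.sum_sub_distrib, hs, sub_self] at this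

/-- The purpose of clipping: with weights at least 1/N every ratio is at most N, so the divergence
stays bounded when rates change or the comparator is replaced. -/
theorem KL_le_log {N : ℕ} (hN : 0 < N) {v w : Fin d → ℝ} (hv : ∀ i, 0 < v i)
    (hs : ∑ i, v i = 1) (hw : ∀ i, 1 / (N : ℝ) ≤ w i) : KL v w ≤ Real.log N := by
  have hN' : (0 : ℝ) < N := by exact_mod_cast hN
  calc KL v w ≤ ∑ i, v i * Real.log N := by
        refine Finset.sum_le_sum fun i _ => mul_le_mul_of_nonneg_left ?_ (hv i).le
        have hwi : 0 < w i := lt_of_lt_of_le (by positivity) (hw i)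
        refine Real.log_le_log (div_pos (hv i) hwi) ?_
        rw [div_le_iff₀ hwi]
        have h1 := le_one_of_sum_eq_one (fun i => (hv i).le) hs i
        have h2 := mul_le_mul_of_nonneg_left (hw i) hN'.le
        rw [mul_one_div_cancel hN'.ne'] at h2
        exact h1.trans h2
    _ = Real.log N := by rw [← Finset.sum_mul, hs, one_mul]

theorem KL_self {w : Fin d → ℝ} (hw : ∀ i, 0 < w i) : KL w w = 0 := by
  refine Finset.sum_eq_zero fun i _ => ?_
  rw [div_self (hw i).ne', Real.log_one, mul_zero]

/-- The three-point inequality of an entropic mirror step. -/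
theorem entropic_prox_inequality {S : Set (Fin d → ℝ)} (hS : Convex ℝ S)
    (hpos : ∀ v ∈ S, ∀ i, 0 < v i) (hsum : ∀ v ∈ S, ∑ i, v i = 1) {θ : ℝ} {ℓ w p v : Fin d → ℝ}
    (hw : ∀ i, 0 < w i) (hp : p ∈ S)
    (hmin : IsMinOn (fun v => θ * ∑ k, ℓ k * v k + KL v w) S p) (hv : v ∈ S) :
    θ * ∑ k, ℓ k * (p k - v k) ≤ KL v w - KL v p - KL p w := by
  -- The objective along the segment from `p` to `v`; minimality of `p` makes its derivative at 0
  -- nonnegative.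
  set g : ℝ → ℝ := fun s => θ * ∑ k, ℓ k * (p k + s * (v k - p k)) +
    ∑ k, (p k + s * (v k - p k)) * Real.log ((p k + s * (v k - p k)) / w k) with hg
  have hder : HasDerivAt g (θ * ∑ k, ℓ k * (v k - p k) +
      ∑ k, (v k - p k) * (Real.log (p k / w k) + 1)) 0 := by
    have hlin : ∀ k, HasDerivAt (fun s : ℝ => p k + s * (v k - p k)) (v k - p k) 0 := fun k => by
      simpa using ((hasDerivAt_id (0 : ℝ)).mul_const (v k - p k)).const_add (p k)
    refine HasDerivAt.add ?_ ?_
    · refine HasDerivAt.const_mul θ ?_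
      exact HasDerivAt.fun_sum fun k _ => (hlin k).const_mul (ℓ k)
    · refine HasDerivAt.fun_sum fun k _ => ?_
      have hpk := (hpos p hp k).ne'
      have hwk := (hw k).ne'
      have hl := ((hlin k).div_const (w k)).log (by simpa using ⟨hpk, hwk⟩)
      refine ((hlin k).fun_mul hl).congr_deriv ?_
      simp only [zero_mul, add_zero]
      field_simp
  have hslope : 0 ≤ θ * ∑ k, ℓ k * (v k - p k) +
      ∑ k, (v k - p k) * (Real.log (p k / w k) + 1) := by
    have ht := (hasDerivWithinAt_iff_tendsto_slope.1 (hder.hasDerivWithinAt (s := Set.Ioo 0 1)))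
    rw [Set.sdiff_singleton_eq_self (by simp)] at ht
    have := left_nhdsWithin_Ioo_neBot (zero_lt_one' ℝ)
    refine ge_of_tendsto ht (eventually_mem_nhdsWithin.mono fun s hs => ?_)
    have hps : p + s • (v - p) ∈ S := hS.add_smul_sub_mem hp hv ⟨hs.1.le, hs.2.le⟩
    have hm := hmin hps
    simp only [Set.mem_ofPred_eq, Pi.add_apply, Pi.smul_apply, Pi.sub_apply, smul_eq_mul, KL] at hm
    rw [slope_def_field]
    refine div_nonneg ?_ (by linarith [hs.1])
    simpa [hg] using hm
  have h1 : ∑ k, (v k - p k) * (Real.log (p k / w k) + 1) = KL v w - KL v p - KL p w := by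
    have h2 : ∑ k, (v k - p k) = 0 := by
      rw [Finset.sum_sub_distrib, hsum v hv, hsum p hp, sub_self]
    simp only [mul_add, mul_one, Finset.sum_add_distrib, h2, add_zero, KL,
      ← Finset.sum_sub_distrib]
    refine Finset.sum_congr rfl fun k _ => ?_
    have hpk := (hpos p hp k).ne'
    have hwk := (hw k).ne'
    have hvk := (hpos v hv k).ne'
    rw [Real.log_div hpk hwk, Real.log_div hvk hwk, Real.log_div hvk hpk]
    ring
  have h3 : ∑ k, ℓ k * (p k - v k) = - ∑ k, ℓ k * (v k - p k) := by
    rw [← Finset.sum_neg_distrib]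
    exact Finset.sum_congr rfl fun k _ => by ring
  rw [h1] at hslope
  rw [h3]
  linarith

/-- The local-norm bound on the one-step stability of an entropic mirror step. -/
theorem sum_mul_sub_sub_KL_div_le {θ : ℝ} (hθ : 0 < θ) {ℓ v w : Fin d → ℝ} (hℓ : ∀ i, 0 ≤ ℓ i)
    (hv : ∀ i, 0 < v i) (hw : ∀ i, 0 < w i) (hs : ∑ i, v i = ∑ i, w i) :
    ∑ i, ℓ i * (w i - v i) - KL v w / θ ≤ θ * ∑ i, w i * ℓ i ^ 2 := by
  -- The added terms have total zero and make the inequality hold coordinate by coordinate.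
  have hKL : KL v w = ∑ i, (v i * Real.log (v i / w i) - v i + w i) := by
    rw [Finset.sum_add_distrib, Finset.sum_sub_distrib, hs, sub_add_cancel]
    rfl
  have key : θ * ∑ i, ℓ i * (w i - v i) - KL v w ≤ θ * (θ * ∑ i, w i * ℓ i ^ 2) := by
    rw [hKL]
    simp only [Finset.mul_sum, ← Finset.sum_sub_distrib]
    refine Finset.sum_le_sum fun i _ => ?_
    set a := θ * ℓ i with ha
    have ha0 : 0 ≤ a := mul_nonneg hθ.le (hℓ i)
    set b := Real.log (v i / w i) with hb
    have hexp : v i = w i * Real.exp b := by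
      rw [hb, Real.exp_log (div_pos (hv i) (hw i)), mul_div_cancel₀ _ (hw i).ne']
    -- The tangent-line bound for `exp`; it eliminates `v i`, leaving only `h2` to be proved about
    -- `a`.
    have h1 : w i * Real.exp (-a) ≥ v i * (1 - (b + a)) := by
      rw [show w i * Real.exp (-a) = v i * Real.exp (-(b + a)) by
        rw [hexp, mul_assoc, ← Real.exp_add]; congr 2; ring]
      refine mul_le_mul_of_nonneg_left ?_ (hv i).le
      linarith [Real.add_one_le_exp (-(b + a))]
    have h2 : Real.exp (-a) ≤ 1 - a + a ^ 2 := by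
      rw [Real.exp_neg]
      have h3 : 0 < 1 + a := by linarith
      have h4 : (Real.exp a)⁻¹ ≤ (1 + a)⁻¹ :=
        inv_anti₀ h3 (by linarith [Real.add_one_le_exp a])
      refine h4.trans ?_
      rw [inv_le_iff_one_le_mul₀ h3]
      nlinarith [pow_nonneg ha0 3]
    have h5 := mul_le_mul_of_nonneg_left h2 (hw i).le
    have e1 : θ * (ℓ i * (w i - v i)) = a * (w i - v i) := by rw [ha]; ring
    have e2 : θ * (θ * (w i * ℓ i ^ 2)) = w i * a ^ 2 := by rw [ha]; ring
    rw [e1, e2]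
    nlinarith
  have h6 : θ * (∑ i, ℓ i * (w i - v i) - KL v w / θ) ≤ θ * (θ * ∑ i, w i * ℓ i ^ 2) := by
    rwa [mul_sub, mul_div_cancel₀ _ hθ.ne']
  exact le_of_mul_le_mul_left h6 hθ

end Hedge

end OSP

/-! ### Small-loss bound for clipped Hedge. -/

namespace OSP

section Hedge

variable {d : ℕ}

theorem convex_clippedSimplex (α : ℝ) : Convex ℝ (clippedSimplex d α) := by
  intro v hv w hw a b ha hb hab
  refine ⟨fun i => ?_, ?_, fun i => ?_⟩
  · have := mul_nonneg ha (hv.1 i)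
    have := mul_nonneg hb (hw.1 i)
    simp only [Pi.add_apply, Pi.smul_apply, smul_eq_mul]
    linarith
  · simp only [Pi.add_apply, Pi.smul_apply, smul_eq_mul, Finset.sum_add_distrib,
      ← Finset.mul_sum, hv.2.1, hw.2.1, mul_one, hab]
  · have h1 := mul_le_mul_of_nonneg_left (hv.2.2 i) ha
    have h2 := mul_le_mul_of_nonneg_left (hw.2.2 i) hb
    simp only [Pi.add_apply, Pi.smul_apply, smul_eq_mul]
    calc α / d = a * (α / d) + b * (α / d) := by rw [← add_mul, hab, one_mul]
      _ ≤ _ := add_le_add h1 h2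

/-- The vertex of the clipped simplex `△_d^{d/N}` next to the `k`-th unit vector. -/
noncomputable def clippedVertex (N : ℕ) (k : Fin d) : Fin d → ℝ :=
  fun i => 1 / (N : ℝ) + if i = k then 1 - d / (N : ℝ) else 0

theorem clippedVertex_mem {N : ℕ} (hN : d < N) (k : Fin d) :
    clippedVertex N k ∈ clippedSimplex d (d / N) := by
  have hN' : (0 : ℝ) < N := by exact_mod_cast (Nat.zero_le d).trans_lt hN
  rw [mem_clippedSimplex_iff]
  refine ⟨?_, fun i => ?_⟩
  · simp only [clippedVertex, Finset.sum_add_distrib, Finset.sum_const, Finset.card_univ,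
      Fintype.card_fin, nsmul_eq_mul, Finset.sum_ite_eq', Finset.mem_univ, if_true]
    ring
  · have : (d : ℝ) / N ≤ 1 := (div_le_one hN').2 (by exact_mod_cast hN.le)
    simp only [clippedVertex]
    split_ifs <;> linarith

/-- The price of comparing with a clipped vertex instead of a pure predictor. With `N = w.N t ≥ t`
it sums harmonically. -/
theorem sum_mul_clippedVertex_le {N : ℕ} {M : ℝ} {ℓ : Fin d → ℝ} (hℓ : ∀ i, 0 ≤ ℓ i)
    (hM : ∀ i, ℓ i ≤ M) (k : Fin d) :
    ∑ i, ℓ i * clippedVertex N k i ≤ ℓ k + d * M / N := by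
  have h1 : ∑ i, ℓ i * clippedVertex N k i = (∑ i, ℓ i) / N + ℓ k * (1 - d / N) := by
    simp only [clippedVertex, mul_add, Finset.sum_add_distrib, mul_ite, mul_zero,
      Finset.sum_ite_eq', Finset.mem_univ, if_true]
    rw [← Finset.sum_mul, mul_one_div]
  have h2 : (∑ i, ℓ i) / N ≤ d * M / N := by
    refine div_le_div_of_nonneg_right ?_ (Nat.cast_nonneg N)
    calc ∑ i, ℓ i ≤ ∑ _i : Fin d, M := Finset.sum_le_sum fun i _ => hM i
      _ = d * M := by simp
  have h3 : 0 ≤ ℓ k * (d / N) := mul_nonneg (hℓ k) (by positivity)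
  rw [h1]
  linarith

theorem sum_one_div_le (T : ℕ) :
    ∑ t ∈ Finset.Icc 1 T, 1 / (t : ℝ) ≤ 1 + Real.log T := by
  have := harmonic_le_one_add_log T
  rw [harmonic_eq_sum_Icc] at this
  push_cast at this
  simpa using this

/-- The constant in the small-loss bound of clipped Hedge. -/
noncomputable def hedgeConst (d N₀ : ℕ) (M ε : ℝ) : ℝ :=
  2 + 2 * d * M + ε ^ 2 + (2 + 2 * (1 + Real.log (2 * N₀))) ^ 2 *
    (3 * (1 + Real.log (2 * N₀)) * M + 1)

namespace IsClippedHedgeRun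

variable {N₀ : ℕ} {ε : ℝ} {L : ℕ → Fin d → ℝ} {w : HedgeTrace d}

theorem N_succ (hw : IsClippedHedgeRun N₀ ε L w) (t : ℕ) :
    w.N (t + 1) = if w.N t < t + 1 then 2 * w.N t else w.N t := by
  simpa using hw.N_step (t + 1) (by omega)

theorem le_N (hw : IsClippedHedgeRun N₀ ε L w) (t : ℕ) : N₀ ≤ w.N t := by
  induction t with
  | zero => exact hw.N_init.ge
  | succ t ih =>
    rw [hw.N_succ]
    split_ifs <;> omega

theorem N_le_succ (hw : IsClippedHedgeRun N₀ ε L w) (t : ℕ) : w.N t ≤ w.N (t + 1) := by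
  rw [hw.N_succ]
  split_ifs <;> omega

theorem self_le_N (hw : IsClippedHedgeRun N₀ ε L w) (hN : 2 ≤ N₀) (t : ℕ) : t ≤ w.N t := by
  induction t with
  | zero => exact Nat.zero_le _
  | succ t ih =>
    have := hw.le_N t
    rw [hw.N_succ]
    split_ifs <;> omega

theorem N_le (hw : IsClippedHedgeRun N₀ ε L w) (t : ℕ) : w.N t ≤ N₀ + 2 * t := by
  induction t with
  | zero => exact hw.N_init.le
  | succ t ih =>
    rw [hw.N_succ]
    split_ifs <;> omega

theorem weights_mem (hw : IsClippedHedgeRun N₀ ε L w) {t : ℕ} (ht : 1 ≤ t) :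
    w.ω t ∈ clippedSimplex d (d / w.N (t - 1)) := by
  obtain rfl | ht' := ht.eq_or_lt
  · simpa [hw.N_init] using hw.ω_init
  · have := hw.ω_mem (t - 1) (by omega)
    rwa [Nat.sub_add_cancel ht] at this

/-- The clipped simplex only grows with the preset, so the current weights remain feasible after a
doubling and can compete in the minimization of round `t`. -/
theorem weights_mem_next (hw : IsClippedHedgeRun N₀ ε L w) (hN : 2 ≤ N₀) {t : ℕ} (ht : 1 ≤ t) :
    w.ω t ∈ clippedSimplex d (d / w.N t) := by
  have h := mem_clippedSimplex_iff.1 (hw.weights_mem ht)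
  refine mem_clippedSimplex_iff.2 ⟨h.1, fun i => le_trans ?_ (h.2 i)⟩
  have h1 : 0 < w.N (t - 1) := by have := hw.le_N (t - 1); omega
  have h2 : w.N (t - 1) ≤ w.N t := by
    have := hw.N_le_succ (t - 1)
    rwa [Nat.sub_add_cancel ht] at this
  exact one_div_le_one_div_of_le (by exact_mod_cast h1) (by exact_mod_cast h2)

theorem pos_of_mem (hw : IsClippedHedgeRun N₀ ε L w) (hN : 2 ≤ N₀) {t : ℕ} {v : Fin d → ℝ}
    (hv : v ∈ clippedSimplex d (d / w.N t)) (i : Fin d) : 0 < v i := by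
  refine lt_of_lt_of_le ?_ ((mem_clippedSimplex_iff.1 hv).2 i)
  have h1 : 0 < w.N t := by have := hw.le_N t; omega
  have : (0 : ℝ) < w.N t := by exact_mod_cast h1
  positivity

theorem weights_pos (hw : IsClippedHedgeRun N₀ ε L w) (hN : 2 ≤ N₀) {t : ℕ} (ht : 1 ≤ t)
    (i : Fin d) : 0 < w.ω t i :=
  hw.pos_of_mem hN (hw.weights_mem ht) i

theorem weights_sum (hw : IsClippedHedgeRun N₀ ε L w) {t : ℕ} (ht : 1 ≤ t) :
    ∑ i, w.ω t i = 1 :=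
  (hw.weights_mem ht).2.1

theorem log_N_pos (hw : IsClippedHedgeRun N₀ ε L w) (hN : 2 ≤ N₀) (t : ℕ) :
    0 < Real.log (w.N t) := by
  have h1 : 1 < w.N t := by have := hw.le_N t; omega
  exact Real.log_pos (by exact_mod_cast h1)

/-- A joint induction again; `σ t ≥ 0` is the minimality of `ω (t + 1)` tested at `ω t`. -/
theorem θ_pos_and_σ_nonneg (hw : IsClippedHedgeRun N₀ ε L w) (hN : 2 ≤ N₀) (hε : 0 < ε) (t : ℕ)
    (ht : 1 ≤ t) : 0 < w.θ t ∧ 0 ≤ w.σ t := by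
  induction t using Nat.strong_induction_on with
  | _ t ih =>
    have hR : 0 < ε + ∑ τ ∈ Finset.Ico 1 t, w.σ τ :=
      add_pos_of_pos_of_nonneg hε <| Finset.sum_nonneg fun τ hτ => by
        rw [Finset.mem_Ico] at hτ
        exact (ih τ hτ.2 hτ.1).2
    have hθ : 0 < w.θ t := by
      rw [hw.θ_eq t ht]
      exact div_pos (hw.log_N_pos hN t) hR
    refine ⟨hθ, ?_⟩
    have h1 := hw.ω_min t ht (hw.weights_mem_next hN ht)
    simp only [Set.mem_ofPred_eq] at h1
    rw [KL_self (hw.weights_pos hN ht), add_zero] at h1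
    have h2 : w.θ t * w.σ t = w.θ t * ∑ k, L t k * w.ω t k -
        (w.θ t * ∑ k, L t k * w.ω (t + 1) k + KL (w.ω (t + 1)) (w.ω t)) := by
      rw [hw.σ_eq t ht, mul_sub, mul_div_cancel₀ _ hθ.ne']
      simp only [mul_sub, Finset.sum_sub_distrib]
      ring
    exact nonneg_of_mul_nonneg_right (by linarith) hθ

theorem KL_next_nonneg (hw : IsClippedHedgeRun N₀ ε L w) (hN : 2 ≤ N₀) {t s : ℕ} (ht : 1 ≤ t)
    {v : Fin d → ℝ} (hv : v ∈ clippedSimplex d (d / w.N s)) : 0 ≤ KL v (w.ω t) :=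
  KL_nonneg (hw.pos_of_mem hN hv) (hw.weights_pos hN ht) (hv.2.1.trans (hw.weights_sum ht).symm)

theorem step_regret_le (hw : IsClippedHedgeRun N₀ ε L w) (hN : 2 ≤ N₀) (hε : 0 < ε) {t : ℕ}
    (ht : 1 ≤ t) {v : Fin d → ℝ} (hv : v ∈ clippedSimplex d (d / w.N t)) :
    ∑ k, L t k * w.ω t k - ∑ k, L t k * v k ≤
      w.σ t + (KL v (w.ω t) / w.θ t - KL v (w.ω (t + 1)) / w.θ t) := by
  have hθ := (hw.θ_pos_and_σ_nonneg hN hε t ht).1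
  have h := entropic_prox_inequality (convex_clippedSimplex _)
    (fun v hv => hw.pos_of_mem hN hv) (fun v hv => hv.2.1) (hw.weights_pos hN ht) (hw.ω_mem t ht)
    (hw.ω_min t ht) hv
  rw [← le_div_iff₀' hθ, sub_div, sub_div] at h
  rw [hw.σ_eq t ht]
  simp only [mul_sub, Finset.sum_sub_distrib] at h ⊢
  linarith

theorem σ_le_inner (hw : IsClippedHedgeRun N₀ ε L w) (hN : 2 ≤ N₀) (hε : 0 < ε) {t : ℕ}
    (ht : 1 ≤ t) (hL : ∀ k, 0 ≤ L t k) : w.σ t ≤ ∑ k, L t k * w.ω t k := by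
  have hθ := (hw.θ_pos_and_σ_nonneg hN hε t ht).1
  have h1 := div_nonneg (hw.KL_next_nonneg hN ht (hw.ω_mem t ht)) hθ.le
  have h2 : 0 ≤ ∑ k, L t k * w.ω (t + 1) k :=
    Finset.sum_nonneg fun k _ => mul_nonneg (hL k) ((hw.ω_mem t ht).1 k)
  rw [hw.σ_eq t ht]
  simp only [mul_sub, Finset.sum_sub_distrib]
  linarith

theorem σ_le_local_norm (hw : IsClippedHedgeRun N₀ ε L w) (hN : 2 ≤ N₀) (hε : 0 < ε) {t : ℕ}
    (ht : 1 ≤ t) (hL : ∀ k, 0 ≤ L t k) : w.σ t ≤ w.θ t * ∑ k, w.ω t k * L t k ^ 2 := by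
  rw [hw.σ_eq t ht]
  exact sum_mul_sub_sub_KL_div_le (hw.θ_pos_and_σ_nonneg hN hε t ht).1 hL
    (hw.weights_pos hN (by omega)) (hw.weights_pos hN ht)
    ((hw.weights_sum (by omega)).trans (hw.weights_sum ht).symm)

/-- The telescoped divergences; each doubling of the horizon preset costs one restart. -/
theorem telescope_le (hw : IsClippedHedgeRun N₀ ε L w) (hd : d < N₀) (hN : 2 ≤ N₀) (hε : 0 < ε)
    (k : Fin d) {n : ℕ} (hn : 1 ≤ n) :
    ∑ t ∈ Finset.Icc 1 n, (KL (clippedVertex (w.N t) k) (w.ω t) / w.θ t -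
        KL (clippedVertex (w.N t) k) (w.ω (t + 1)) / w.θ t)
        + KL (clippedVertex (w.N n) k) (w.ω (n + 1)) / w.θ n ≤
      (ε + ∑ τ ∈ Finset.Ico 1 n, w.σ τ) *
        (1 + (Real.log (w.N n) - Real.log N₀) / Real.log 2) := by
  have hlog2 : 0 < Real.log 2 := Real.log_pos one_lt_two
  set R : ℕ → ℝ := fun n => ε + ∑ τ ∈ Finset.Ico 1 n, w.σ τ with hRdef
  have hσ := fun t ht => (hw.θ_pos_and_σ_nonneg hN hε t ht).2
  have hθ0 := fun t ht => (hw.θ_pos_and_σ_nonneg hN hε t ht).1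
  have hR : ∀ n, 0 < R n := fun n =>
    add_pos_of_pos_of_nonneg hε <| Finset.sum_nonneg fun τ hτ => hσ τ (Finset.mem_Ico.1 hτ).1
  have hRs : ∀ n, 1 ≤ n → R (n + 1) = R n + w.σ n := fun n hn => by
    simp only [hRdef, Finset.sum_Ico_succ_top hn, add_assoc]
  have hv : ∀ t, clippedVertex (w.N t) k ∈ clippedSimplex d (d / w.N t) := fun t =>
    clippedVertex_mem (hd.trans_le (hw.le_N t)) k
  have hNpos : ∀ t, 0 < w.N t := fun t => by have := hw.le_N t; omega
  have hθ : ∀ (t : ℕ) (z : ℝ), 1 ≤ t → z / w.θ t = z / Real.log (w.N t) * R t := fun t z ht => by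
    rw [hw.θ_eq t ht, div_div_eq_mul_div, div_mul_eq_mul_div]
  have hKL : ∀ t, 1 ≤ t →
      KL (clippedVertex (w.N t) k) (w.ω t) / Real.log (w.N t) ≤ 1 := fun t ht => by
    rw [div_le_one (hw.log_N_pos hN t)]
    exact KL_le_log (hNpos t) (hw.pos_of_mem hN (hv t)) (hv t).2.1
      (mem_clippedSimplex_iff.1 (hw.weights_mem_next hN ht)).2
  have hKLR : ∀ t, 1 ≤ t → KL (clippedVertex (w.N t) k) (w.ω t) / w.θ t ≤ R t := fun t ht => by
    rw [hθ t _ ht]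
    exact mul_le_of_le_one_left (hR t).le (hKL t ht)
  change _ ≤ R n * _
  have hlogN : ∀ n, 0 ≤ (Real.log (w.N n) - Real.log N₀) / Real.log 2 := fun n => by
    refine div_nonneg (sub_nonneg.2 (Real.log_le_log ?_ ?_)) hlog2.le
    · exact_mod_cast (by omega : 0 < N₀)
    · exact_mod_cast hw.le_N n
  induction n, hn using Nat.le_induction with
  | base =>
    simp only [Finset.Icc_self, Finset.sum_singleton]
    have h1 := hKLR 1 le_rfl
    have h2 := mul_nonneg (hR 1).le (hlogN 1)
    linarith
  | succ n hn ih =>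
    rw [Finset.sum_Icc_succ_top (by omega)]
    have hσn := hσ n hn
    have hlogn := hlogN n
    have hRn := hRs n hn
    -- On a doubling the old divergence is dropped and the new one costs at most `R (n + 1)`, paid
    -- for by the unit increase of log₂ N. Otherwise the vertex is unchanged and only the rate
    -- moves, at cost at most `σ n`.
    by_cases hlt : w.N n < n + 1
    · have h1 : (Real.log (w.N (n + 1)) - Real.log N₀) / Real.log 2 =
          1 + (Real.log (w.N n) - Real.log N₀) / Real.log 2 := by
        have h2 : (w.N n : ℝ) ≠ 0 := by exact_mod_cast (hNpos n).ne'
        rw [hw.N_succ, if_pos hlt]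
        push_cast
        rw [Real.log_mul two_ne_zero h2]
        field_simp
        ring
      have h3 := hKLR (n + 1) (by omega)
      have h4 := div_nonneg (hw.KL_next_nonneg hN (t := n + 1) (by omega) (hv n)) (hθ0 n hn).le
      rw [h1]
      have h5 := mul_nonneg hσn hlogn
      rw [hRn] at h3 ⊢
      linarith
    · have hN1 : w.N (n + 1) = w.N n := by rw [hw.N_succ, if_neg hlt]
      have h1 : KL (clippedVertex (w.N (n + 1)) k) (w.ω (n + 1)) / w.θ (n + 1) -
          KL (clippedVertex (w.N n) k) (w.ω (n + 1)) / w.θ n ≤ w.σ n := by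
        have h2 := hKL (n + 1) (by omega)
        rw [hθ (n + 1) _ (by omega), hθ n _ hn, hN1, ← mul_sub, hRn, add_sub_cancel_left]
        rw [hN1] at h2
        exact mul_le_of_le_one_left hσn h2
      rw [hN1] at h1 ⊢
      have h5 := mul_nonneg hσn hlogn
      rw [hRn]
      linarith

/-- Self-bounding as for `sum_δ_le_sqrt`, now with θR = log N and the local norm ∑ ω L² ≤ M⟨L, ω⟩.
The bound involves the loss of the algorithm itself, which is what yields a small-loss rate. -/
theorem sq_stability_le (hw : IsClippedHedgeRun N₀ ε L w) (hN : 2 ≤ N₀) (hε : 0 < ε) {M : ℝ}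
    (hL : ∀ t, 1 ≤ t → ∀ k, 0 ≤ L t k ∧ L t k ≤ M) {T : ℕ} {Λ : ℝ}
    (hΛ : ∀ t, t ≤ T → Real.log (w.N t) ≤ Λ) :
    (ε + ∑ t ∈ Finset.Icc 1 T, w.σ t) ^ 2 ≤
      ε ^ 2 + (2 * Λ + 1) * M * ∑ t ∈ Finset.Icc 1 T, ∑ k, L t k * w.ω t k := by
  have hθσ := hw.θ_pos_and_σ_nonneg hN hε
  suffices h : ∀ n, n ≤ T → (ε + ∑ t ∈ Finset.Icc 1 n, w.σ t) ^ 2 ≤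
      ε ^ 2 + (2 * Λ + 1) * M * ∑ t ∈ Finset.Icc 1 n, ∑ k, L t k * w.ω t k from h T le_rfl
  intro n
  induction n with
  | zero => simp
  | succ n ih =>
    intro hn
    have ih := ih (by omega)
    have hn1 : 1 ≤ n + 1 := by omega
    rw [Finset.sum_Icc_succ_top hn1, Finset.sum_Icc_succ_top hn1, ← add_assoc]
    set R := ε + ∑ t ∈ Finset.Icc 1 n, w.σ t with hR
    set W := ∑ k, L (n + 1) k * w.ω (n + 1) k with hW
    have hR0 : 0 < R := add_pos_of_pos_of_nonneg hε <|
      Finset.sum_nonneg fun t ht => (hθσ t (Finset.mem_Icc.1 ht).1).2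
    have hL0 := fun k => (hL _ hn1 k).1
    have hω := fun k => (hw.weights_pos hN hn1 k).le
    have hW0 : 0 ≤ W := Finset.sum_nonneg fun k _ => mul_nonneg (hL0 k) (hω k)
    have hWM : W ≤ M := by
      calc W ≤ ∑ k, M * w.ω (n + 1) k :=
            Finset.sum_le_sum fun k _ => mul_le_mul_of_nonneg_right (hL _ hn1 k).2 (hω k)
        _ = M := by rw [← Finset.mul_sum, hw.weights_sum hn1, mul_one]
    have hM0 : 0 ≤ M := hW0.trans hWM
    have hsq : ∑ k, w.ω (n + 1) k * L (n + 1) k ^ 2 ≤ M * W := by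
      rw [hW, Finset.mul_sum]
      refine Finset.sum_le_sum fun k _ => ?_
      have := mul_le_mul_of_nonneg_right (hL _ hn1 k).2 (mul_nonneg (hL0 k) (hω k))
      linarith
    have h1 := hw.σ_le_local_norm hN hε hn1 hL0
    have h2 := hw.σ_le_inner hN hε hn1 hL0
    have h3 : w.θ (n + 1) * R = Real.log (w.N (n + 1)) := by
      rw [hw.θ_eq _ hn1]
      exact div_mul_cancel₀ _ hR0.ne'
    have h4 : R * w.σ (n + 1) ≤ Λ * (M * W) := by
      calc R * w.σ (n + 1) ≤ R * (w.θ (n + 1) * (M * W)) :=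
            mul_le_mul_of_nonneg_left
              (h1.trans (mul_le_mul_of_nonneg_left hsq (hθσ _ hn1).1.le)) hR0.le
        _ = Real.log (w.N (n + 1)) * (M * W) := by rw [← h3]; ring
        _ ≤ Λ * (M * W) := mul_le_mul_of_nonneg_right (hΛ _ hn) (mul_nonneg hM0 hW0)
    have h5 : w.σ (n + 1) ^ 2 ≤ M * W := by
      calc w.σ (n + 1) ^ 2 ≤ W ^ 2 := pow_le_pow_left₀ (hθσ _ hn1).2 h2 2
        _ ≤ M * W := by rw [sq]; exact mul_le_mul_of_nonneg_right hWM hW0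
    linarith

theorem log_N_le (hw : IsClippedHedgeRun N₀ ε L w) (hN : 2 ≤ N₀) {t T : ℕ} (htT : t ≤ T)
    (hT : 1 ≤ T) : Real.log (w.N t) ≤ (1 + Real.log (2 * N₀)) * (1 + Real.log T) := by
  have hT' : (1 : ℝ) ≤ T := by exact_mod_cast hT
  have hN' : (2 : ℝ) ≤ N₀ := by exact_mod_cast hN
  have h1 : (w.N t : ℝ) ≤ 2 * N₀ * T := by
    have h2 : w.N t ≤ N₀ + 2 * t := hw.N_le t
    have h3 : (w.N t : ℝ) ≤ N₀ + 2 * T := by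
      exact_mod_cast h2.trans (by omega)
    nlinarith
  have h4 : (0 : ℝ) < w.N t := by
    have := hw.le_N t
    exact_mod_cast (by omega : 0 < w.N t)
  have h5 := Real.log_le_log h4 h1
  rw [Real.log_mul (by positivity) (by positivity)] at h5
  have h6 : 0 ≤ Real.log T := Real.log_nonneg hT'
  have h7 : 0 ≤ Real.log (2 * N₀) := Real.log_nonneg (by linarith)
  nlinarith [mul_nonneg h6 h7]

/-- The small-loss bound of clipped Hedge. -/
theorem cumulative_loss_le (hw : IsClippedHedgeRun N₀ ε L w) (hd : d < N₀) (hN : 2 ≤ N₀)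
    (hε : 0 < ε) {M : ℝ} (hM : 0 ≤ M) (hL : ∀ t, 1 ≤ t → ∀ k, 0 ≤ L t k ∧ L t k ≤ M) (k : Fin d)
    {T : ℕ} (hT : 1 ≤ T) :
    ∑ t ∈ Finset.Icc 1 T, ∑ i, L t i * w.ω t i ≤
      hedgeConst d N₀ M ε * (1 + Real.log T) ^ 3 *
        (1 + ∑ t ∈ Finset.Icc 1 T, L t k) := by
  rw [hedgeConst]
  have hθσ := hw.θ_pos_and_σ_nonneg hN hε
  have hT' : (1 : ℝ) ≤ T := by exact_mod_cast hT
  have hlogT : 0 ≤ Real.log T := Real.log_nonneg hT'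
  have hlogN : 0 ≤ Real.log (2 * N₀) := by
    have : (2 : ℝ) ≤ N₀ := by exact_mod_cast hN
    exact Real.log_nonneg (by linarith)
  have hNT := fun t (ht : t ≤ T) => hw.log_N_le hN ht hT
  have hsq := hw.sq_stability_le hN hε hL hNT
  have htel := hw.telescope_le hd hN hε k hT
  have hlogNT := hNT T le_rfl
  set Λ := 1 + Real.log T with hΛdef
  set q := 1 + Real.log (2 * N₀) with hq
  set W := ∑ t ∈ Finset.Icc 1 T, ∑ i, L t i * w.ω t i with hW
  set V := ∑ t ∈ Finset.Icc 1 T, L t k with hV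
  set R := ε + ∑ t ∈ Finset.Icc 1 T, w.σ t with hR
  have hΛ : 1 ≤ Λ := by linarith
  have hq1 : 1 ≤ q := by linarith
  have hqΛ : 1 ≤ q * Λ := by nlinarith
  have hV0 : 0 ≤ V := Finset.sum_nonneg fun t ht => (hL t (Finset.mem_Icc.1 ht).1 k).1
  have hW0 : 0 ≤ W := Finset.sum_nonneg fun t ht => Finset.sum_nonneg fun i _ =>
    have ht := (Finset.mem_Icc.1 ht).1
    mul_nonneg (hL t ht i).1 (hw.weights_pos hN ht i).le
  have hσsum : 0 ≤ ∑ t ∈ Finset.Icc 1 T, w.σ t :=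
    Finset.sum_nonneg fun t ht => (hθσ t (Finset.mem_Icc.1 ht).1).2
  have hR0 : 0 < R := by linarith
  have hRT : ε + ∑ τ ∈ Finset.Ico 1 T, w.σ τ ≤ R := by
    rw [hR, ← show Finset.Ico 1 (T + 1) = Finset.Icc 1 T from rfl, Finset.sum_Ico_succ_top hT]
    linarith [(hθσ T hT).2]
  have hsum : W ≤ V + d * M * Λ + ∑ t ∈ Finset.Icc 1 T, w.σ t +
      ∑ t ∈ Finset.Icc 1 T, (KL (clippedVertex (w.N t) k) (w.ω t) / w.θ t -
        KL (clippedVertex (w.N t) k) (w.ω (t + 1)) / w.θ t) := by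
    have h1 : d * M * ∑ t ∈ Finset.Icc 1 T, 1 / (t : ℝ) ≤ d * M * Λ :=
      mul_le_mul_of_nonneg_left (sum_one_div_le T) (by positivity)
    refine le_trans ?_ (add_le_add_left (add_le_add_left (add_le_add_right h1 V) _) _)
    rw [hW, hV, Finset.mul_sum, ← Finset.sum_add_distrib, ← Finset.sum_add_distrib,
      ← Finset.sum_add_distrib]
    refine Finset.sum_le_sum fun t ht => ?_
    have ht := (Finset.mem_Icc.1 ht).1
    have h2 := hw.step_regret_le hN hε ht (clippedVertex_mem (hd.trans_le (hw.le_N t)) k)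
    have h3 := sum_mul_clippedVertex_le (N := w.N t) (fun i => (hL t ht i).1)
      (fun i => (hL t ht i).2) k
    have h4 : d * M / w.N t ≤ d * M * (1 / (t : ℝ)) := by
      rw [mul_one_div]
      have h5 := hw.self_le_N hN t
      have h6 : (0 : ℝ) < t := by exact_mod_cast ht
      have h7 : (t : ℝ) ≤ w.N t := by exact_mod_cast h5
      gcongr
    linarith
  have hlast : 0 ≤ KL (clippedVertex (w.N T) k) (w.ω (T + 1)) / w.θ T :=
    div_nonneg (hw.KL_next_nonneg hN (by omega)
      (clippedVertex_mem (hd.trans_le (hw.le_N T)) k)) (hθσ T hT).1.le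
  have hfac0 : 0 ≤ (Real.log (w.N T) - Real.log N₀) / Real.log 2 := by
    refine div_nonneg (sub_nonneg.2 (Real.log_le_log ?_ ?_)) (Real.log_pos one_lt_two).le
    · exact_mod_cast (by omega : 0 < N₀)
    · exact_mod_cast hw.le_N T
  have hfac : (Real.log (w.N T) - Real.log N₀) / Real.log 2 ≤ 2 * q * Λ := by
    rw [div_le_iff₀ (Real.log_pos one_lt_two)]
    have h1 : 0 ≤ Real.log N₀ := Real.log_natCast_nonneg _
    have h2 : 1 / 2 ≤ Real.log 2 := by linarith [Real.log_two_gt_d9]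
    nlinarith
  have hmul : (ε + ∑ τ ∈ Finset.Ico 1 T, w.σ τ) *
      (1 + (Real.log (w.N T) - Real.log N₀) / Real.log 2) ≤ R * (1 + 2 * q * Λ) := by
    gcongr
  have hW1 : W ≤ V + d * M * Λ + (2 + 2 * q) * Λ * R := by
    have h1 : R * (2 + 2 * q * Λ) ≤ (2 + 2 * q) * Λ * R := by
      rw [mul_comm]
      refine mul_le_mul_of_nonneg_right ?_ hR0.le
      linarith
    linarith
  have hR2 : R ^ 2 ≤ ε ^ 2 + 3 * q * M * Λ * W := by
    have h1 : (2 * (q * Λ) + 1) * (M * W) ≤ 3 * (q * Λ) * (M * W) :=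
      mul_le_mul_of_nonneg_right (by linarith) (mul_nonneg hM hW0)
    linarith
  -- absorb the square root of the cumulative loss
  set B := (2 + 2 * q) with hB
  -- The weight in Young's inequality: it makes `R ^ 2 / S ≤ ε ^ 2 + W`, so doubling `hW1` leaves
  -- one `W` on the left. The summand 1 keeps `S` positive when `M = 0`.
  set S := 3 * q * M * Λ + 1 with hS
  have hS0 : 1 ≤ S := by
    have : 0 ≤ 3 * q * M * Λ := by positivity
    linarith
  have hyoung : 2 * (B * Λ * R) ≤ B ^ 2 * Λ ^ 2 * S + ε ^ 2 + W := by
    have h1 : R ^ 2 / S ≤ ε ^ 2 + W := by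
      rw [div_le_iff₀ (by linarith)]
      have h2 : ε ^ 2 ≤ ε ^ 2 * S := le_mul_of_one_le_right (sq_nonneg _) hS0
      have h3 : 3 * q * M * Λ * W ≤ W * S := by rw [hS]; linarith
      linarith
    have h4 : 0 ≤ (B * Λ * S - R) ^ 2 / S := by positivity
    have h5 : (B * Λ * S - R) ^ 2 / S = B ^ 2 * Λ ^ 2 * S - 2 * (B * Λ * R) + R ^ 2 / S := by
      have : S ≠ 0 := by linarith
      field_simp
      ring
    linarith
  have hfinal : W ≤ 2 * V + 2 * d * M * Λ + B ^ 2 * Λ ^ 2 * S + ε ^ 2 := by linarith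
  have hΛ3 : 1 ≤ Λ ^ 3 := one_le_pow₀ hΛ
  have hΛ13 : Λ ≤ Λ ^ 3 := le_self_pow₀ hΛ (by norm_num)
  have hSΛ : Λ ^ 2 * S ≤ (3 * q * M + 1) * Λ ^ 3 := by
    have h1 : Λ ^ 2 ≤ Λ ^ 3 := pow_le_pow_right₀ hΛ (by norm_num)
    rw [hS]
    linarith
  have e1 : 2 * V ≤ 2 * Λ ^ 3 * V := by nlinarith
  have e2 : 2 * d * M * Λ ≤ 2 * d * M * Λ ^ 3 := by gcongr
  have e3 : B ^ 2 * (Λ ^ 2 * S) ≤ B ^ 2 * ((3 * q * M + 1) * Λ ^ 3) := by gcongr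
  have e4 : ε ^ 2 ≤ ε ^ 2 * Λ ^ 3 := le_mul_of_one_le_right (sq_nonneg _) hΛ3
  have e5 : 0 ≤ (2 * d * M + ε ^ 2 + B ^ 2 * (3 * q * M + 1)) * Λ ^ 3 * V := by positivity
  have e6 : 0 ≤ 2 * Λ ^ 3 := by positivity
  linarith

end IsClippedHedgeRun

end Hedge

end OSP

/-! ### Mixed predictors, reduction of the game to two players, and assembly. -/

namespace OSP

section Mixture

variable {E F : Type*} {d : ℕ} {ω : ℕ → Fin d → ℝ} {h : Fin d → ℕ → E → F → ℝ} {t : ℕ}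

theorem convexOn_mixture [NormedAddCommGroup E] [NormedSpace ℝ E] {X : Set E}
    (hX : Convex ℝ X) (hω : ∀ k, 0 ≤ ω t k) {y : F}
    (hh : ∀ k, ConvexOn ℝ X fun x => h k t x y) :
    ConvexOn ℝ X fun x => mixture ω h t x y := by
  refine ⟨hX, fun a ha b hb p q hp hq hpq => ?_⟩
  simp only [mixture, smul_eq_mul, Finset.mul_sum, ← Finset.sum_add_distrib]
  refine Finset.sum_le_sum fun k _ => ?_
  have h1 := mul_le_mul_of_nonneg_left ((hh k).2 ha hb hp hq hpq) (hω k)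
  simp only [smul_eq_mul] at h1
  linarith

theorem convexOn_neg_mixture [NormedAddCommGroup F] [NormedSpace ℝ F] {Y : Set F}
    (hY : Convex ℝ Y) (hω : ∀ k, 0 ≤ ω t k) {x : E}
    (hh : ∀ k, ConcaveOn ℝ Y (h k t x)) :
    ConvexOn ℝ Y fun y => -mixture ω h t x y := by
  refine ConcaveOn.neg ⟨hY, fun a ha b hb p q hp hq hpq => ?_⟩
  simp only [mixture, smul_eq_mul, Finset.mul_sum, ← Finset.sum_add_distrib]
  refine Finset.sum_le_sum fun k _ => ?_
  have h1 := mul_le_mul_of_nonneg_left ((hh k).2 ha hb hp hq hpq) (hω k)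
  simp only [smul_eq_mul] at h1
  linarith

/-- The link between the two algorithms: the error of the mixture is at most the loss that Hedge
suffers. -/
theorem abs_sub_mixture_le (hω : ∀ k, 0 ≤ ω t k) (hsum : ∑ k, ω t k = 1) {a : ℝ} {x : E} {y : F}
    {ℓ : Fin d → ℝ} (hℓ : ∀ k, |a - h k t x y| ≤ ℓ k) :
    |a - mixture ω h t x y| ≤ ∑ k, ℓ k * ω t k := by
  have h1 : a - mixture ω h t x y = ∑ k, ω t k * (a - h k t x y) := by
    simp only [mixture, mul_sub, Finset.sum_sub_distrib, ← Finset.sum_mul, hsum, one_mul]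
  rw [h1]
  refine (Finset.abs_sum_le_sum_abs _ _).trans (Finset.sum_le_sum fun k _ => ?_)
  rw [abs_mul, abs_of_nonneg (hω k), mul_comm]
  exact mul_le_mul_of_nonneg_right (hℓ k) (hω k)

theorem mixture_sub_le (hω : ∀ k, 0 ≤ ω t k) (hsum : ∑ k, ω t k = 1) {x x' : E} {y y' : F} {m : ℝ}
    (hm : ∀ k, h k t x y - h k t x' y' ≤ m) :
    mixture ω h t x y - mixture ω h t x' y' ≤ m := by
  calc mixture ω h t x y - mixture ω h t x' y'
      = ∑ k, ω t k * (h k t x y - h k t x' y') := by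
        simp only [mixture, mul_sub, Finset.sum_sub_distrib]
    _ ≤ ∑ k, ω t k * m := Finset.sum_le_sum fun k _ => mul_le_mul_of_nonneg_left (hm k) (hω k)
    _ = m := by rw [← Finset.sum_mul, hsum, one_mul]

end Mixture

section Game

variable {E F : Type*} [NormedAddCommGroup E] [NormedSpace ℝ E]
  [NormedAddCommGroup F] [NormedSpace ℝ F] {X : Set E} {Y : Set F}

theorem proxRegretConst_nonneg {D c : ℝ} (hD : 0 ≤ D) (hc : 0 < c) : 0 ≤ proxRegretConst D c := by
  have h1 : 0 ≤ D / c := div_nonneg hD hc.le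
  have h2 : 0 ≤ Real.log (1 + D / c) := Real.log_nonneg (by linarith)
  rw [proxRegretConst]
  positivity

theorem hedgeConst_nonneg {d N₀ : ℕ} (hN : 2 ≤ N₀) {M ε : ℝ} (hM : 0 ≤ M) :
    0 ≤ hedgeConst d N₀ M ε := by
  have h1 : (2 : ℝ) ≤ N₀ := by exact_mod_cast hN
  have h2 : 0 ≤ Real.log (2 * N₀) := Real.log_nonneg (by linarith)
  rw [hedgeConst]
  positivity

namespace SubgradientBoundedOn

variable {GX GY : ℝ} {f : E → F → ℝ}

theorem sub_le_left (hf : SubgradientBoundedOn X Y GX GY f) {y : F} (hy : y ∈ Y) :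
    ∀ v ∈ X, ∀ v' ∈ X, f v y - f v' y ≤ GX * ‖v - v'‖ := by
  intro v hv v' hv'
  obtain ⟨g, hg, hsub⟩ := (hf v hv y hy).1
  have h1 := hsub v' hv'
  have h2 := (le_abs_self _).trans ((g.le_opNorm (v - v')).trans
    (mul_le_mul_of_nonneg_right hg (norm_nonneg _)))
  rw [map_sub] at h1 h2
  linarith

theorem sub_le_right (hf : SubgradientBoundedOn X Y GX GY f) {x : E} (hx : x ∈ X) :
    ∀ v ∈ Y, ∀ v' ∈ Y, -f x v - -f x v' ≤ GY * ‖v - v'‖ := by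
  intro v hv v' hv'
  obtain ⟨g, hg, hsub⟩ := (hf x hx v hv).2
  have h1 := hsub v' hv'
  have h2 := (le_abs_self _).trans ((g.le_opNorm (v - v')).trans
    (mul_le_mul_of_nonneg_right hg (norm_nonneg _)))
  rw [map_sub] at h1 h2
  linarith

/-- Predictors are not assumed continuous, so boundedness comes from the subgradients. It is needed
because `sSup` in `rho` is meaningful only for a bounded set. -/
theorem exists_abs_le (hf : SubgradientBoundedOn X Y GX GY f) (hX : Bornology.IsBounded X)
    (hY : Bornology.IsBounded Y) {x₀ : E} {y₀ : F} (hx₀ : x₀ ∈ X) (hy₀ : y₀ ∈ Y) :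
    ∃ B, ∀ x ∈ X, ∀ y ∈ Y, |f x y| ≤ B := by
  have hGX : 0 ≤ GX := by
    obtain ⟨g, hg, -⟩ := (hf x₀ hx₀ y₀ hy₀).1
    exact (norm_nonneg g).trans hg
  have hGY : 0 ≤ GY := by
    obtain ⟨g, hg, -⟩ := (hf x₀ hx₀ y₀ hy₀).2
    exact (norm_nonneg g).trans hg
  refine ⟨|f x₀ y₀| + GX * Metric.diam X + GY * Metric.diam Y, fun x hx y hy => ?_⟩
  have hdX : ∀ v ∈ X, ∀ v' ∈ X, GX * ‖v - v'‖ ≤ GX * Metric.diam X := fun v hv v' hv' =>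
    mul_le_mul_of_nonneg_left (dist_eq_norm v v' ▸ Metric.dist_le_diam_of_mem hX hv hv') hGX
  have hdY : ∀ v ∈ Y, ∀ v' ∈ Y, GY * ‖v - v'‖ ≤ GY * Metric.diam Y := fun v hv v' hv' =>
    mul_le_mul_of_nonneg_left (dist_eq_norm v v' ▸ Metric.dist_le_diam_of_mem hY hv hv') hGY
  have h1 := hf.sub_le_left hy x hx x₀ hx₀
  have h2 := hf.sub_le_left hy x₀ hx₀ x hx
  have h3 := hf.sub_le_right hx₀ y hy y₀ hy₀
  have h4 := hf.sub_le_right hx₀ y₀ hy₀ y hy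
  have h5 := hdX x hx x₀ hx₀
  have h6 := hdX x₀ hx₀ x hx
  have h7 := hdY y hy y₀ hy₀
  have h8 := hdY y₀ hy₀ y hy
  rw [abs_le]
  constructor <;> linarith [neg_abs_le (f x₀ y₀), le_abs_self (f x₀ y₀)]

theorem abs_sub_le_rho {h : E → F → ℝ} (hf : SubgradientBoundedOn X Y GX GY f)
    (hh : SubgradientBoundedOn X Y GX GY h) (hX : Bornology.IsBounded X)
    (hY : Bornology.IsBounded Y) {x : E} {y : F} (hx : x ∈ X) (hy : y ∈ Y) :
    |f x y - h x y| ≤ rho X Y f h := by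
  obtain ⟨B, hB⟩ := hf.exists_abs_le hX hY hx hy
  obtain ⟨B', hB'⟩ := hh.exists_abs_le hX hY hx hy
  refine le_csSup ⟨B + B', ?_⟩ ⟨(x, y), ⟨hx, hy⟩, rfl⟩
  rintro _ ⟨q, hq, rfl⟩
  exact (abs_sub _ _).trans (add_le_add (hB _ hq.1 _ hq.2) (hB' _ hq.1 _ hq.2))

end SubgradientBoundedOn

namespace IsOptOPPMRun

variable {φ : E → EReal} {ψ : F → EReal} {Lφ Lψ ε c1 c2 : ℝ} {f h : ℕ → E → F → ℝ}
  {r : Trace E F}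

theorem isProxRun_left (hr : IsOptOPPMRun X Y φ ψ Lφ Lψ ε c1 c2 f h r) :
    IsProxRun X φ Lφ ε c1 (fun t v => f t v (r.y t)) (fun t v => h t v (r.y t)) r.x r.xt r.xBest
      r.gx r.gxt r.C1 r.η r.δ1 where
  a_init := hr.xt_init
  b_init := hr.gxt_init
  u_mem t := by
    rcases t.eq_zero_or_pos with rfl | ht
    · exact hr.xBest_zero
    · exact hr.xBest_mem t ht
  C_init := hr.C1_init
  η_eq := hr.η_eq
  x_mem := hr.x_mem
  x_min t ht v hv := by
    have := hr.saddle t ht v hv (r.y t) (hr.y_mem t ht)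
    simp only [Set.mem_ofPred_eq] at this ⊢
    linarith
  g_mem := hr.gx_mem
  C_step := hr.C1_step
  a_mem := hr.xt_mem
  a_min := hr.xt_min
  b_mem := hr.gxt_mem
  δ_eq := hr.δ1_eq

/-- The maximizing player minimizes the negated payoffs; in the saddle inequality the terms of the
other player cancel. -/
theorem isProxRun_right (hr : IsOptOPPMRun X Y φ ψ Lφ Lψ ε c1 c2 f h r) :
    IsProxRun Y ψ Lψ ε c2 (fun t v => -f t (r.x t) v) (fun t v => -h t (r.x t) v) r.y r.yt r.yBest
      r.gy r.gyt r.C2 r.γ r.δ2 where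
  a_init := hr.yt_init
  b_init := hr.gyt_init
  u_mem t := by
    rcases t.eq_zero_or_pos with rfl | ht
    · exact hr.yBest_zero
    · exact hr.yBest_mem t ht
  C_init := hr.C2_init
  η_eq := hr.γ_eq
  x_mem := hr.y_mem
  x_min t ht v hv := by
    have := hr.saddle t ht (r.x t) (hr.x_mem t ht) v hv
    simp only [Set.mem_ofPred_eq] at this ⊢
    linarith
  g_mem := hr.gy_mem
  C_step := hr.C2_step
  a_mem := hr.yt_mem
  a_min t ht v hv := by
    have := hr.yt_max t ht hv
    simp only [Set.mem_ofPred_eq] at this ⊢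
    linarith
  b_mem := hr.gyt_mem
  δ_eq t ht := by
    rw [hr.δ2_eq t ht]
    ring

theorem sSup_payoff_eq (hr : IsOptOPPMRun X Y φ ψ Lφ Lψ ε c1 c2 f h r) {t : ℕ} (ht : 1 ≤ t) :
    sSup (f t (r.x t) '' Y) = f t (r.x t) (r.yBest t) := by
  refine IsGreatest.csSup_eq ⟨⟨_, hr.yBest_mem t ht, rfl⟩, ?_⟩
  rintro _ ⟨v, hv, rfl⟩
  exact hr.yBest_max t ht hv

theorem sInf_payoff_eq (hr : IsOptOPPMRun X Y φ ψ Lφ Lψ ε c1 c2 f h r) {t : ℕ} (ht : 1 ≤ t) :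
    sInf ((fun u => f t u (r.y t)) '' X) = f t (r.xBest t) (r.y t) := by
  refine IsLeast.csInf_eq ⟨⟨_, hr.xBest_mem t ht, rfl⟩, ?_⟩
  rintro _ ⟨v, hv, rfl⟩
  exact hr.xBest_min t ht hv

theorem dualityGap_eq (hr : IsOptOPPMRun X Y φ ψ Lφ Lψ ε c1 c2 f h r) (T : ℕ) :
    dualityGap X Y f r.x r.y T =
      ∑ t ∈ Finset.Icc 1 T, (f t (r.x t) (r.y t) - f t (r.xBest t) (r.y t)) +
        ∑ t ∈ Finset.Icc 1 T, (-f t (r.x t) (r.y t) - -f t (r.x t) (r.yBest t)) := by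
  rw [dualityGap, ← Finset.sum_sub_distrib, ← Finset.sum_add_distrib]
  refine Finset.sum_congr rfl fun t ht => ?_
  have ht := (Finset.mem_Icc.1 ht).1
  rw [hr.sSup_payoff_eq ht, hr.sInf_payoff_eq ht]
  ring

/-- No minimax theorem is needed: the max-min value lies between the payoffs at the two best
responses, so each sign of the difference is controlled by one player's regret. -/
theorem neRegret_le (hr : IsOptOPPMRun X Y φ ψ Lφ Lψ ε c1 c2 f h r) (hX : IsCompact X)
    (hf : ∀ t, 1 ≤ t → ContinuousOn (fun q : E × F => f t q.1 q.2) (X ×ˢ Y)) (T : ℕ) :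
    neRegret X Y f r.x r.y T ≤
      max (∑ t ∈ Finset.Icc 1 T, (f t (r.x t) (r.y t) - f t (r.xBest t) (r.y t)))
        (∑ t ∈ Finset.Icc 1 T, (-f t (r.x t) (r.y t) - -f t (r.x t) (r.yBest t))) := by
  have hval : ∀ t, 1 ≤ t →
      f t (r.xBest t) (r.y t) ≤ sSup ((fun v => sInf ((fun u => f t u v) '' X)) '' Y) ∧
        sSup ((fun v => sInf ((fun u => f t u v) '' X)) '' Y) ≤ f t (r.x t) (r.yBest t) := by
    intro t ht
    have hub : ∀ v ∈ Y, sInf ((fun u => f t u v) '' X) ≤ f t (r.x t) (r.yBest t) := by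
      intro v hv
      have hc : ContinuousOn (fun u => f t u v) X :=
        (hf t ht).comp (f := fun u => (u, v)) (by fun_prop) fun u hu => ⟨hu, hv⟩
      exact (csInf_le (hX.bddBelow_image hc) ⟨_, hr.x_mem t ht, rfl⟩).trans (hr.yBest_max t ht hv)
    constructor
    · rw [← hr.sInf_payoff_eq ht]
      refine le_csSup ⟨f t (r.x t) (r.yBest t), ?_⟩ ⟨_, hr.y_mem t ht, rfl⟩
      rintro _ ⟨v, hv, rfl⟩
      exact hub v hv
    · refine csSup_le ⟨_, _, hr.y_mem t ht, rfl⟩ ?_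
      rintro _ ⟨v, hv, rfl⟩
      exact hub v hv
  rw [neRegret, ← Finset.sum_sub_distrib, abs_le']
  constructor
  · refine le_trans (Finset.sum_le_sum fun t ht => ?_) (le_max_left _ _)
    linarith [(hval t (Finset.mem_Icc.1 ht).1).1]
  · refine le_trans ?_ (le_max_right _ _)
    rw [← Finset.sum_neg_distrib]
    refine Finset.sum_le_sum fun t ht => ?_
    linarith [(hval t (Finset.mem_Icc.1 ht).1).2]

end IsOptOPPMRun

/-- The bound with an explicit constant. -/
theorem max_dualityGap_neRegret_le {d N₀ : ℕ} {GX GY Lφ Lψ Linf ε ε' c1 c2 : ℝ}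
    (hd : 1 ≤ d) (hdN : d < N₀) (hLφ : 0 < Lφ) (hLψ : 0 < Lψ) (hε : 0 < ε) (hε' : 0 < ε')
    (hc1 : 0 < c1) (hc2 : 0 < c2) {φ : E → EReal} {ψ : F → EReal}
    {f : ℕ → E → F → ℝ} {h : Fin d → ℕ → E → F → ℝ} {r : Trace E F} {w : HedgeTrace d}
    (hX : IsCompact X) (hXc : Convex ℝ X) (hY : IsCompact Y) (hYc : Convex ℝ Y)
    (hφ : IsRegularizer X Lφ φ) (hψ : IsRegularizer Y Lψ ψ)
    (hf : ∀ t, 1 ≤ t → ContinuousOn (fun q : E × F => f t q.1 q.2) (X ×ˢ Y) ∧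
      ConvexConcaveOn X Y (f t) ∧ SubgradientBoundedOn X Y GX GY (f t))
    (hh : ∀ k t, 1 ≤ t → ConvexConcaveOn X Y (h k t) ∧
      SubgradientBoundedOn X Y GX GY (h k t) ∧ rho X Y (f t) (h k t) ≤ Linf)
    (hr : IsOptOPPMRun X Y φ ψ Lφ Lψ ε c1 c2 f (mixture w.ω h) r)
    (hw : IsClippedHedgeRun N₀ ε' (predictorLoss f h r) w) {T : ℕ} (hT : 1 ≤ T) :
    max (dualityGap X Y f r.x r.y T) (neRegret X Y f r.x r.y T) ≤
      (proxRegretConst (Metric.diam X) c1 + proxRegretConst (Metric.diam Y) c2) *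
        (proxStabilityConst (Metric.diam X) GX Lφ (2 * Linf) ε c1 +
          proxStabilityConst (Metric.diam Y) GY Lψ (2 * Linf) ε c2 +
          (ε + 2 * hedgeConst d N₀ Linf ε')) *
        (1 + Real.log T) ^ 4 *
        (1 + min (⨅ k, cumError X Y f (h k) T)
          √((1 + (pathLength r.xBest T + pathLength r.yBest T)) * T)) := by
  have hN : 2 ≤ N₀ := by omega
  have hT' : (1 : ℝ) ≤ T := by exact_mod_cast hT
  have hω := fun t (ht : 1 ≤ t) k => (hw.weights_pos hN ht k).le
  have hωs := fun t (ht : 1 ≤ t) => hw.weights_sum ht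
  have hpx := hr.isProxRun_left
  have hpy := hr.isProxRun_right
  set L := predictorLoss f h r with hLdef
  have hLrho : ∀ t, 1 ≤ t → ∀ k, 0 ≤ L t k ∧ L t k ≤ rho X Y (f t) (h k t) := by
    intro t ht k
    have hb : ∀ x ∈ X, ∀ y ∈ Y, |f t x y - h k t x y| ≤ rho X Y (f t) (h k t) := fun x hx y hy =>
      (hf t ht).2.2.abs_sub_le_rho (hh k t ht).2.1 hX.isBounded hY.isBounded hx hy
    exact ⟨(abs_nonneg _).trans (le_max_left _ _),
      max_le (hb _ (hr.x_mem t ht) _ (hr.y_mem t ht))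
        (max_le (hb _ (hr.xt_mem t ht) _ (hr.y_mem t ht))
          (hb _ (hr.x_mem t ht) _ (hr.yt_mem t ht)))⟩
  have hL : ∀ t, 1 ≤ t → ∀ k, 0 ≤ L t k ∧ L t k ≤ Linf := fun t ht k =>
    ⟨(hLrho t ht k).1, (hLrho t ht k).2.trans (hh k t ht).2.2⟩
  have hLinf : 0 ≤ Linf := (hL 1 le_rfl ⟨0, hd⟩).1.trans (hL 1 le_rfl ⟨0, hd⟩).2
  have hinner : ∀ t, 1 ≤ t → ∑ k, L t k * w.ω t k ≤ Linf := fun t ht =>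
    calc ∑ k, L t k * w.ω t k ≤ ∑ k, Linf * w.ω t k :=
          Finset.sum_le_sum fun k _ => mul_le_mul_of_nonneg_right (hL t ht k).2 (hω t ht k)
      _ = Linf := by rw [← Finset.mul_sum, hωs t ht, mul_one]
  have hfx : ∀ t, 1 ≤ t → ConvexOn ℝ X fun v => f t v (r.y t) := fun t ht =>
    (hf t ht).2.1.1 _ (hr.y_mem t ht)
  have hfy : ∀ t, 1 ≤ t → ConvexOn ℝ Y fun v => -f t (r.x t) v := fun t ht =>
    ((hf t ht).2.1.2 _ (hr.x_mem t ht)).neg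
  have hhx : ∀ t, 1 ≤ t → ConvexOn ℝ X fun v => mixture w.ω h t v (r.y t) := fun t ht =>
    convexOn_mixture hXc (hω t ht) fun k => (hh k t ht).1.1 _ (hr.y_mem t ht)
  have hhy : ∀ t, 1 ≤ t → ConvexOn ℝ Y fun v => -mixture w.ω h t (r.x t) v := fun t ht =>
    convexOn_neg_mixture hYc (hω t ht) fun k => (hh k t ht).1.2 _ (hr.x_mem t ht)
  have hηx := hpx.η_pos_and_δ_nonneg hφ hXc hLφ hε hc1 hhx
  have hηy := hpy.η_pos_and_δ_nonneg hψ hYc hLψ hε hc2 hhy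
  -- `predictorLoss` takes the maximum over exactly the points at which `δ1` and `δ2` compare `f`
  -- with the mixture.
  have hδx : ∀ t, 1 ≤ t → r.δ1 t ≤ 2 * ∑ k, L t k * w.ω t k := fun t ht =>
    hpx.δ_le_of_abs_le hφ ht (hηx t ht).1
      (abs_sub_mixture_le (hω t ht) (hωs t ht) fun k => le_max_left _ _)
      (abs_sub_mixture_le (hω t ht) (hωs t ht) fun k =>
        (le_max_left _ _).trans (le_max_right _ _))
  have hδy : ∀ t, 1 ≤ t → r.δ2 t ≤ 2 * ∑ k, L t k * w.ω t k := fun t ht => by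
    refine hpy.δ_le_of_abs_le hψ ht (hηy t ht).1 ?_ ?_
    · rw [neg_sub_neg, abs_sub_comm]
      exact abs_sub_mixture_le (hω t ht) (hωs t ht) fun k => le_max_left _ _
    · rw [neg_sub_neg, abs_sub_comm]
      exact abs_sub_mixture_le (hω t ht) (hωs t ht) fun k =>
        (le_max_right _ _).trans (le_max_right _ _)
  have hregx := hpx.regret_le hφ hX.isBounded hXc hLφ hε hc1 hfx hhx hT
  have hregy := hpy.regret_le hψ hY.isBounded hYc hLψ hε hc2 hfy hhy hT
  have hQx := hpx.sum_δ_le_sqrt hφ hXc hLφ hε hc1 hhx (G := GX) (M := 2 * Linf)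
    (fun t ht => (hf t ht).2.2.sub_le_left (hr.y_mem t ht))
    (fun t ht v hv v' hv' => mixture_sub_le (hω t ht) (hωs t ht) fun k =>
      (hh k t ht).2.1.sub_le_left (hr.y_mem t ht) v hv v' hv')
    (fun t ht => (hδx t ht).trans (by linarith [hinner t ht])) hT
  have hQy := hpy.sum_δ_le_sqrt hψ hYc hLψ hε hc2 hhy (G := GY) (M := 2 * Linf)
    (fun t ht => (hf t ht).2.2.sub_le_right (hr.x_mem t ht))
    (fun t ht v hv v' hv' => by
      rw [neg_sub_neg, norm_sub_rev]
      refine mixture_sub_le (hω t ht) (hωs t ht) fun k => ?_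
      have := (hh k t ht).2.1.sub_le_right (hr.x_mem t ht) v hv v' hv'
      rw [norm_sub_rev] at this
      linarith)
    (fun t ht => (hδy t ht).trans (by linarith [hinner t ht])) hT
  have hgap := hr.dualityGap_eq T
  have hne := hr.neRegret_le hX (fun t ht => (hf t ht).1) T
  have hK1 := proxRegretConst_nonneg (Metric.diam_nonneg (s := X)) hc1
  have hK2 := proxRegretConst_nonneg (Metric.diam_nonneg (s := Y)) hc2
  have hK3 := hedgeConst_nonneg (d := d) hN hLinf (ε := ε')
  have hS1 : 0 ≤ proxStabilityConst (Metric.diam X) GX Lφ (2 * Linf) ε c1 := Real.sqrt_nonneg _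
  have hS2 : 0 ≤ proxStabilityConst (Metric.diam Y) GY Lψ (2 * Linf) ε c2 := Real.sqrt_nonneg _
  set K1 := proxRegretConst (Metric.diam X) c1
  set K2 := proxRegretConst (Metric.diam Y) c2
  set K3 := hedgeConst d N₀ Linf ε' with hK3def
  set S1 := proxStabilityConst (Metric.diam X) GX Lφ (2 * Linf) ε c1
  set S2 := proxStabilityConst (Metric.diam Y) GY Lψ (2 * Linf) ε c2
  set Q1 := ε + ∑ t ∈ Finset.Icc 1 T, r.δ1 t with hQ1
  set Q2 := ε + ∑ t ∈ Finset.Icc 1 T, r.δ2 t with hQ2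
  set Λ := 1 + Real.log T with hΛdef
  have hΛ : 1 ≤ Λ := by linarith [Real.log_nonneg hT']
  have hΛ3 : 1 ≤ Λ ^ 3 := one_le_pow₀ hΛ
  have hQ1pos : 0 ≤ Q1 := add_nonneg hε.le <|
    Finset.sum_nonneg fun t ht => (hηx t (Finset.mem_Icc.1 ht).1).2
  have hQ2pos : 0 ≤ Q2 := add_nonneg hε.le <|
    Finset.sum_nonneg fun t ht => (hηy t (Finset.mem_Icc.1 ht).1).2
  have hP1 := pathLength_nonneg r.xBest T
  have hP2 := pathLength_nonneg r.yBest T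
  set rt := √((1 + (pathLength r.xBest T + pathLength r.yBest T)) * T) with hrt
  have hrt0 : 0 ≤ rt := Real.sqrt_nonneg _
  -- The exponent 4 is made of one logarithm from `regret_le` and three from `cumulative_loss_le`.
  have hbound : ∀ (m : ℝ), 0 ≤ m → Q1 ≤ (S1 + S2 + (ε + 2 * K3)) * Λ ^ 3 * (1 + m) →
      Q2 ≤ (S1 + S2 + (ε + 2 * K3)) * Λ ^ 3 * (1 + m) →
      max (dualityGap X Y f r.x r.y T) (neRegret X Y f r.x r.y T) ≤
        (K1 + K2) * (S1 + S2 + (ε + 2 * K3)) * Λ ^ 4 * (1 + m) := by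
    intro m hm h1 h2
    have h3 := mul_le_mul_of_nonneg_left h1 (mul_nonneg hK1 (by linarith : 0 ≤ Λ))
    have h4 := mul_le_mul_of_nonneg_left h2 (mul_nonneg hK2 (by linarith : 0 ≤ Λ))
    have h5 : 0 ≤ K1 * Λ * Q1 := by positivity
    have h6 : 0 ≤ K2 * Λ * Q2 := by positivity
    have h7 : K1 * Λ * Q1 + K2 * Λ * Q2 ≤
        (K1 + K2) * (S1 + S2 + (ε + 2 * K3)) * Λ ^ 4 * (1 + m) := by linarith
    refine (max_le ?_ ?_).trans h7
    · rw [hgap]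
      exact add_le_add hregx hregy
    · refine hne.trans (max_le ?_ ?_)
      · linarith
      · linarith
  rcases min_choice (⨅ k, cumError X Y f (h k) T) rt with hmin | hmin
  · rw [hmin]
    have : Nonempty (Fin d) := ⟨⟨0, hd⟩⟩
    -- The best predictor in hindsight serves as the Hedge comparator.
    obtain ⟨k, hk⟩ := exists_eq_ciInf_of_finite (f := fun k => cumError X Y f (h k) T)
    rw [← hk]
    have hLV : ∑ t ∈ Finset.Icc 1 T, L t k ≤ cumError X Y f (h k) T :=
      Finset.sum_le_sum fun t ht => (hLrho t (Finset.mem_Icc.1 ht).1 k).2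
    have hV0 : 0 ≤ cumError X Y f (h k) T :=
      (Finset.sum_nonneg fun t ht => (hLrho t (Finset.mem_Icc.1 ht).1 k).1).trans hLV
    set V := cumError X Y f (h k) T
    have hW := hw.cumulative_loss_le hdN hN hε' hLinf hL k hT
    rw [← hK3def] at hW
    have hW2 : ∑ t ∈ Finset.Icc 1 T, ∑ i, L t i * w.ω t i ≤ K3 * Λ ^ 3 * (1 + V) :=
      hW.trans (mul_le_mul_of_nonneg_left (by linarith) (by positivity))
    have hone : 1 ≤ Λ ^ 3 * (1 + V) := by nlinarith
    have hε2 : ε ≤ ε * (Λ ^ 3 * (1 + V)) := le_mul_of_one_le_right hε.le hone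
    have hnn : 0 ≤ (S1 + S2) * (Λ ^ 3 * (1 + V)) := by positivity
    have hsum : ∀ δ : ℕ → ℝ, (∀ t, 1 ≤ t → δ t ≤ 2 * ∑ k, L t k * w.ω t k) →
        ε + ∑ t ∈ Finset.Icc 1 T, δ t ≤ (S1 + S2 + (ε + 2 * K3)) * Λ ^ 3 * (1 + V) := by
      intro δ hδ
      have h1 : ∑ t ∈ Finset.Icc 1 T, δ t ≤
          2 * ∑ t ∈ Finset.Icc 1 T, ∑ i, L t i * w.ω t i := by
        rw [Finset.mul_sum]
        exact Finset.sum_le_sum fun t ht => hδ t (Finset.mem_Icc.1 ht).1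
      linarith
    exact hbound V hV0 (hsum _ hδx) (hsum _ hδy)
  · rw [hmin]
    have hrt1 : √((1 + pathLength r.xBest T) * T) ≤ rt := by
      rw [hrt]
      gcongr
      linarith
    have hrt2 : √((1 + pathLength r.yBest T) * T) ≤ rt := by
      rw [hrt]
      gcongr
      linarith
    have hbase : (S1 + S2) * rt ≤ (S1 + S2 + (ε + 2 * K3)) * Λ ^ 3 * (1 + rt) := by
      calc (S1 + S2) * rt ≤ (S1 + S2 + (ε + 2 * K3)) * (1 + rt) :=
            mul_le_mul (by linarith) (by linarith) hrt0 (by positivity)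
        _ ≤ (S1 + S2 + (ε + 2 * K3)) * Λ ^ 3 * (1 + rt) := by
            gcongr
            exact le_mul_of_one_le_right (by positivity) hΛ3
    refine hbound rt hrt0 (le_trans ?_ hbase) (le_trans ?_ hbase)
    · exact hQx.trans (mul_le_mul (by linarith) hrt1 (Real.sqrt_nonneg _) (by positivity))
    · exact hQy.trans (mul_le_mul (by linarith) hrt2 (Real.sqrt_nonneg _) (by positivity))

end Game

end OSP

/-- `Õ(B)` is `K (1 + log T)^p (1 + B)`: the exponent `p` is absolute, and `K` depends only on the
numerical parameters of the problem, not on the horizon, the spaces, the payoffs, the predictors or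
the execution. -/
theorem mainTheorem3 :
    ∃ p : ℕ, ∀ (d N₀ : ℕ) (DX DY GX GY Lφ Lψ Linf ε ε' c1 c2 : ℝ),
      1 ≤ d → d < N₀ → 0 < Lφ → 0 < Lψ → 0 < ε → 0 < ε' → 0 < c1 → 0 < c2 →
      ∃ K : ℝ,
        ∀ (E : Type*) [NormedAddCommGroup E] [NormedSpace ℝ E]
          (F : Type*) [NormedAddCommGroup F] [NormedSpace ℝ F]
          (X : Set E) (Y : Set F) (φ : E → EReal) (ψ : F → EReal)
          (f : ℕ → E → F → ℝ) (h : Fin d → ℕ → E → F → ℝ)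
          (r : OSP.Trace E F) (w : OSP.HedgeTrace d),
          -- feasible sets
          IsCompact X → Convex ℝ X → Metric.diam X = DX →
          IsCompact Y → Convex ℝ Y → Metric.diam Y = DY →
          -- regularizers
          OSP.IsRegularizer X Lφ φ → OSP.IsRegularizer Y Lψ ψ →
          -- payoff functions
          (∀ t, 1 ≤ t → ContinuousOn (fun q : E × F => f t q.1 q.2) (X ×ˢ Y) ∧
            OSP.ConvexConcaveOn X Y (f t) ∧ OSP.SubgradientBoundedOn X Y GX GY (f t)) →
          -- predictors
          (∀ k t, 1 ≤ t → OSP.ConvexConcaveOn X Y (h k t) ∧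
            OSP.SubgradientBoundedOn X Y GX GY (h k t) ∧ OSP.rho X Y (f t) (h k t) ≤ Linf) →
          -- execution of the two algorithms, coupled with each other
          OSP.IsOptOPPMRun X Y φ ψ Lφ Lψ ε c1 c2 f (OSP.mixture w.ω h) r →
          OSP.IsClippedHedgeRun N₀ ε' (OSP.predictorLoss f h r) w →
          ∀ T : ℕ, 1 ≤ T →
            max (OSP.dualityGap X Y f r.x r.y T) (OSP.neRegret X Y f r.x r.y T) ≤
              K * (1 + Real.log T) ^ p *
                (1 + min (⨅ k, OSP.cumError X Y f (h k) T)
                  √((1 + (OSP.pathLength r.xBest T + OSP.pathLength r.yBest T)) * T)) := by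
  refine ⟨4, fun d N₀ DX DY GX GY Lφ Lψ Linf ε ε' c1 c2 hd hdN hLφ hLψ hε hε' hc1 hc2 =>
    ⟨(OSP.proxRegretConst DX c1 + OSP.proxRegretConst DY c2) *
      (OSP.proxStabilityConst DX GX Lφ (2 * Linf) ε c1 +
        OSP.proxStabilityConst DY GY Lψ (2 * Linf) ε c2 +
        (ε + 2 * OSP.hedgeConst d N₀ Linf ε')), ?_⟩⟩
  intro E _ _ F _ _ X Y φ ψ f h r w hX hXc hDX hY hYc hDY hφ hψ hf hh hr hw T hT
  subst hDX hDY
  exact OSP.max_dualityGap_neRegret_le hd hdN hLφ hLψ hε hε' hc1 hc2 hX hXc hY hYc hφ hψ hf hh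
    hr hw hT
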